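/- **Definitions.** A *2-colex* is a finite nonempty connected graph (multiple edges allowed) cellularly embedded in a closed oriented surface of arbitrary genus, such that every vertex has degree $3$ and the faces can be coloured with three colours so that the two sides of every edge have different colours. Let $\mathcal V$, $\mathcal F$ be its sets of vertices and faces, $V=|\mathcal V|$, $F=|\mathcal F|$. Exactly three distinct faces $\mathfrak f_a,\mathfrak g_a,\mathfrak h_a$ meet at a vertex $a$. For couplings $J=(J_a)_{a\in\mathcal V}\in\mathbb R^{\mathcal V}$ and inverse temperature $\beta\in\mathbb R$, the 3-body Ising model has, for spins $\sigma\in\{1,-1\}^{\mathcal F}$, energy and partition function $$H(\sigma)=-\sum_{a\in\mathcal V}J_a\,\sigma_{\mathfrak f_a}\sigma_{\mathfrak g_a}\sigma_{\mathfrak h_a},\qquad \mathcal Z=\sum_{\sigma}e^{-\beta H(\sigma)},$$ and we put $$\gamma=\sqrt{2^{F+2}}\prod_{a\in\mathcal V}\sqrt{e^{2\beta J_a}+e^{-2\beta J_a}}.$$ *Model of computation.* A probabilistic real-RAM program is a finite program built by sequencing, conditionals and while-loops, working on registers and arrays of natural numbers and of real numbers. The following cost one step each: setting a register to a natural-number literal;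 addition and truncated subtraction of natural numbers; $+,-,\times,\div,\sqrt{\ },\exp$ on real numbers; reading or writing an array entry at an index held in a register; flipping an independent fair coin; testing $=$ or $<$ on natural registers or $<$ on real registers. **Theorem.** There are a probabilistic real-RAM program and a constant $C$ such that the following holds for every 2-colex (with any enumeration of its vertices and faces), all $\beta\in\mathbb R$, $J\in\mathbb R^{\mathcal V}$, $\varepsilon>0$ and $0\le p<1$. Given as input $V$, $F$, the $V\times F$ vertex-face incidence matrix, $\beta$, $J$, $\varepsilon$ and $p$, the program halts, for all outcomes of the coin flips, after at most $$C\cdot V^3\cdot\max\{1,\varepsilon^{-2}\}\cdot\max\Bigl\{1,\log\frac1{1-p}\Bigr\}$$ steps (hence in time $O\bigl(V^3\,\varepsilon^{-2}\log\frac1{1-p}\bigr)$ for $\varepsilon\le 1$ and $p$ bounded away from $0$), and with probability at least $p$ it outputs a real number $\mathcal Z_{\mathrm{est}}$ with $$|\mathcal Z_{\mathrm{est}}-\mathcal Z|\le\frac{\gamma}{\sqrt{2^{F-2}}}\,\varepsilon .$$ -/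

import Mathlib

/-! ## 2-colexes and their three-body Ising models -/

/-- A combinatorial map: a nonempty connected graph (loops and multiple edges allowed) cellularly
embedded in a closed oriented surface of any genus. `D` is the set of darts (oriented edges). `rev`
reverses a dart, `rot` sends a dart to the next one, counterclockwise, around its source vertex. -/
structure SurfaceMap (D : Type) where
  rot : Equiv.Perm D
  rev : Equiv.Perm D
  rev_rev : ∀ d, rev (rev d) = d
  rev_ne : ∀ d, rev d ≠ d
  nonempty : Nonempty D
  connected : MulAction.IsPretransitive (Subgroup.closure {rot, rev} : Subgroup (Equiv.Perm D)) D

namespace SurfaceMap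

variable {D : Type}

/-- Vertices are the cycles of `rot`. -/
def Vertex (M : SurfaceMap D) : Type := Quotient (Equiv.Perm.SameCycle.setoid M.rot)

/-- Faces are the cycles of `rot⁻¹ * rev`; the cycle of `d` is the face to the left of `d`. -/
def Face (M : SurfaceMap D) : Type := Quotient (Equiv.Perm.SameCycle.setoid (M.rot⁻¹ * M.rev))

/-- The source vertex of a dart. -/
def vertexOf (M : SurfaceMap D) (d : D) : M.Vertex :=
  Quotient.mk (Equiv.Perm.SameCycle.setoid M.rot) d

/-- The face to the left of a dart. -/
def faceOf (M : SurfaceMap D) (d : D) : M.Face :=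
  Quotient.mk (Equiv.Perm.SameCycle.setoid (M.rot⁻¹ * M.rev)) d

/-- A map is a 2-colex if every vertex has degree 3 (it is the source of three darts) and the faces
can be coloured with three colours so that the two sides of every edge have different colours. -/
structure IsTwoColex (M : SurfaceMap D) : Prop where
  degree : ∀ a : M.Vertex, {d : D | M.vertexOf d = a}.ncard = 3
  colorable : ∃ c : M.Face → Fin 3, ∀ d : D, c (M.faceOf d) ≠ c (M.faceOf (M.rev d))

noncomputable instance [Finite D] (M : SurfaceMap D) : Fintype M.Vertex :=
  @Fintype.ofFinite _ (Quotient.finite _)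

noncomputable instance [Finite D] (M : SurfaceMap D) : Fintype M.Face :=
  @Fintype.ofFinite _ (Quotient.finite _)

/-- The vertex `a` lies on the face `f`. The three corners at `a` are the ones to the left of the
three darts with source `a`. -/
def Incident (M : SurfaceMap D) (a : M.Vertex) (f : M.Face) : Prop :=
  ∃ d : D, M.vertexOf d = a ∧ M.faceOf d = f

open Classical in
/-- Energy `H(σ) = - ∑ₐ Jₐ σ_f σ_g σ_h` of a spin configuration on the faces, where `f, g, h` are
the three faces at the vertex `a`. -/
noncomputable def energy [Finite D] (M : SurfaceMap D) (J : M.Vertex → ℝ) (σ : M.Face → ℤˣ) : ℝ :=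
  -∑ a, J a * ∏ f with M.Incident a f, ((σ f : ℤ) : ℝ)

open Classical in
/-- The partition function `∑_σ exp (-β H(σ))`. -/
noncomputable def partitionFunction [Finite D] (M : SurfaceMap D) (β : ℝ) (J : M.Vertex → ℝ) : ℝ :=
  ∑ σ : M.Face → ℤˣ, Real.exp (-β * M.energy J σ)

/-- `γ = √(2 ^ (F + 2)) * ∏ₐ √(exp (2 β Jₐ) + exp (-2 β Jₐ))`. -/
noncomputable def gammaFactor [Finite D] (M : SurfaceMap D) (β : ℝ) (J : M.Vertex → ℝ) : ℝ :=
  Real.sqrt (2 ^ (Fintype.card M.Face + 2)) *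
    ∏ a, Real.sqrt (Real.exp (2 * β * J a) + Real.exp (-(2 * β * J a)))

end SurfaceMap

/-! ## Probabilistic real-RAM programs with a step count -/

namespace RealRAM

/-- A memory state: scalar registers and arrays of natural numbers, scalar registers and arrays of
real numbers, and the stream of coin flips that have not been used yet. -/
structure State where
  nreg : ℕ → ℕ
  rreg : ℕ → ℝ
  narr : ℕ → ℕ → ℕ
  rarr : ℕ → ℕ → ℝ
  coins : ℕ → Bool

/-- The unit-cost instructions. The arguments are numbers of registers and of arrays; the only
literals are natural numbers. -/
inductive Instr where
  | nconst (d n : ℕ)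
  | nadd (d a b : ℕ)
  | nsub (d a b : ℕ)
  | nload (d A i : ℕ)
  | nstore (A i a : ℕ)
  | rconst (d n : ℕ)
  | radd (d a b : ℕ)
  | rsub (d a b : ℕ)
  | rmul (d a b : ℕ)
  | rdiv (d a b : ℕ)
  | rsqrt (d a : ℕ)
  | rexp (d a : ℕ)
  | rload (d A i : ℕ)
  | rstore (A i a : ℕ)
  | flip (d : ℕ)

/-- The unit-cost tests: comparisons of two registers. -/
inductive Test where
  | neq (a b : ℕ)
  | nlt (a b : ℕ)
  | rlt (a b : ℕ)

/-- Programs. -/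
inductive Prog where
  | skip
  | instr (i : Instr)
  | seq (P Q : Prog)
  | cond (b : Test) (P Q : Prog)
  | loop (b : Test) (P : Prog)

/-- `setN s d n` writes `n` into the natural-number register `d`. -/
def State.setN (s : State) (d n : ℕ) : State :=
  { s with nreg := Function.update s.nreg d n }

/-- `setR s d x` writes `x` into the real register `d`. -/
noncomputable def State.setR (s : State) (d : ℕ) (x : ℝ) : State :=
  { s with rreg := Function.update s.rreg d x }

/-- The effect of an instruction. `nsub` is truncated subtraction, division by `0` and the square
root of a negative number give `0`. `flip d` consumes one coin. -/
noncomputable def Instr.apply : Instr → State → State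
  | nconst d n, s => s.setN d n
  | nadd d a b, s => s.setN d (s.nreg a + s.nreg b)
  | nsub d a b, s => s.setN d (s.nreg a - s.nreg b)
  | nload d A i, s => s.setN d (s.narr A (s.nreg i))
  | nstore A i a, s =>
      { s with
        narr := Function.update s.narr A
          (Function.update (s.narr A) (s.nreg i) (s.nreg a)) }
  | rconst d n, s => s.setR d n
  | radd d a b, s => s.setR d (s.rreg a + s.rreg b)
  | rsub d a b, s => s.setR d (s.rreg a - s.rreg b)
  | rmul d a b, s => s.setR d (s.rreg a * s.rreg b)
  | rdiv d a b, s => s.setR d (s.rreg a / s.rreg b)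
  | rsqrt d a, s => s.setR d (Real.sqrt (s.rreg a))
  | rexp d a, s => s.setR d (Real.exp (s.rreg a))
  | rload d A i, s => s.setR d (s.rarr A (s.nreg i))
  | rstore A i a, s =>
      { s with
        rarr := Function.update s.rarr A
          (Function.update (s.rarr A) (s.nreg i) (s.rreg a)) }
  | flip d, s =>
      { s with
        nreg := Function.update s.nreg d (if s.coins 0 then 1 else 0)
        coins := fun n => s.coins (n + 1) }

/-- The truth of a test in a state. -/
def Test.Holds : Test → State → Prop
  | neq a b, s => s.nreg a = s.nreg b
  | nlt a b, s => s.nreg a < s.nreg b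
  | rlt a b, s => s.rreg a < s.rreg b

/-- `Exec P s t s'`: the program `P`, started in `s`, halts in `s'` after exactly `t` steps, where
every executed instruction and every evaluated test counts as one step. -/
inductive Exec : Prog → State → ℕ → State → Prop where
  | skip (s : State) : Exec Prog.skip s 0 s
  | instr (i : Instr) (s : State) : Exec (Prog.instr i) s 1 (i.apply s)
  | seq {P Q : Prog} {s s' s'' : State} {t t' : ℕ} :
      Exec P s t s' → Exec Q s' t' s'' → Exec (Prog.seq P Q) s (t + t') s''
  | cond_true {b : Test} {P Q : Prog} {s s' : State} {t : ℕ} :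
      b.Holds s → Exec P s t s' → Exec (Prog.cond b P Q) s (t + 1) s'
  | cond_false {b : Test} {P Q : Prog} {s s' : State} {t : ℕ} :
      ¬ b.Holds s → Exec Q s t s' → Exec (Prog.cond b P Q) s (t + 1) s'
  | loop_true {b : Test} {P : Prog} {s s' s'' : State} {t t' : ℕ} :
      b.Holds s → Exec P s t s' → Exec (Prog.loop b P) s' t' s'' →
        Exec (Prog.loop b P) s (t + t' + 1) s''
  | loop_false {b : Test} {P : Prog} {s : State} :
      ¬ b.Holds s → Exec (Prog.loop b P) s 1 s

/-- For a given coin sequence, the final state and the number of steps are unique. -/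
theorem Exec.unique {P : Prog} {s s₁ s₂ : State} {t₁ t₂ : ℕ} (h₁ : Exec P s t₁ s₁)
    (h₂ : Exec P s t₂ s₂) : t₁ = t₂ ∧ s₁ = s₂ := by
  induction h₁ generalizing t₂ s₂ with
  | skip s => cases h₂; exact ⟨rfl, rfl⟩
  | instr i s => cases h₂; exact ⟨rfl, rfl⟩
  | seq _ _ ih ih' =>
    cases h₂ with
    | seq h h' =>
      obtain ⟨rfl, rfl⟩ := ih h
      obtain ⟨rfl, rfl⟩ := ih' h'
      exact ⟨rfl, rfl⟩
  | cond_true hb _ ih =>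
    cases h₂ with
    | cond_true _ h => obtain ⟨rfl, rfl⟩ := ih h; exact ⟨rfl, rfl⟩
    | cond_false hb' _ => exact absurd hb hb'
  | cond_false hb _ ih =>
    cases h₂ with
    | cond_true hb' _ => exact absurd hb' hb
    | cond_false _ h => obtain ⟨rfl, rfl⟩ := ih h; exact ⟨rfl, rfl⟩
  | loop_true hb _ _ ih ih' =>
    cases h₂ with
    | loop_true _ h h' =>
      obtain ⟨rfl, rfl⟩ := ih h
      obtain ⟨rfl, rfl⟩ := ih' h'
      exact ⟨rfl, rfl⟩
    | loop_false hb' => exact absurd hb hb'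
  | loop_false hb =>
    cases h₂ with
    | loop_true hb' _ _ => exact absurd hb' hb
    | loop_false _ => exact ⟨rfl, rfl⟩

/-- The law of an infinite sequence of independent fair coin flips. -/
noncomputable def coinMeasure : MeasureTheory.Measure (ℕ → Bool) :=
  MeasureTheory.Measure.infinitePi fun _ => (PMF.uniformOfFintype Bool).toMeasure

end RealRAM

open Classical in
/-- The input of the algorithm, for a 2-colex whose vertices and faces are enumerated by `eV` and
`eF`: natural registers `0, 1` hold `V, F`, natural array `0` holds the `V × F` vertex-face
incidence matrix row by row, real registers `0, 1, 2` hold `β, ε, p`, real array `0` holds the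
couplings; everything else is `0`. -/
noncomputable def SurfaceMap.input {D : Type} (M : SurfaceMap D) {V F : ℕ}
    (eV : Fin V ≃ M.Vertex) (eF : Fin F ≃ M.Face) (β : ℝ) (J : M.Vertex → ℝ) (ε p : ℝ)
    (ω : ℕ → Bool) : RealRAM.State where
  nreg k := if k = 0 then V else if k = 1 then F else 0
  rreg k := if k = 0 then β else if k = 1 then ε else if k = 2 then p else 0
  narr A k := if A = 0 ∧ ∃ (v : Fin V) (f : Fin F), k = v * F + f ∧ M.Incident (eV v) (eF f)
    then 1 else 0
  rarr A k := if h : A = 0 ∧ k < V then J (eV ⟨k, h.2⟩) else 0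
  coins := ω

/-! Write spins as signs of a vector y over the field with two elements. With A the vertex-face
incidence matrix, 𝒵 = ∑_y ∏_a w_a((Ay)_a), where w_a takes the values exp(±βJ_a)
(`partitionFunction_eq`). The allowed error is 4εn, where n is the Euclidean norm of the tensor
product of all the w_a (`error_eq`). So an unbiased nonnegative estimator of 𝒵 with second moment
O(n²), averaged over O(ε⁻² log(1/(1-p))) samples, is enough.

The estimator is importance sampling in good coordinates. Column operations do not change the sum
over y and bring A to a matrix A' in which every nonzero column j has a pivot row that is the j-th
unit vector; thus y_j is read off at its pivot vertex. Coordinates are drawn independently, y_j with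
probability proportional to the squared weight at its pivot, and the product of all vertex weights
is divided by the probability. In the second moment the pivot weights cancel against the
probabilities and leave their squared norms; what remains is a sum over y of the squared weights in
the non-pivot rows.

Here the 2-colex enters: any two faces share an even number of vertices, and every face has an even
number of corners (`sum_incident_mul`), so the columns of A, and hence of A', are pairwise
orthogonal and self-orthogonal. If A'd vanishes off the pivot rows, its product with column j is
d_j, so d_j = 0 (`Reduced.eq_zero`). Hence y is determined by its non-pivot rows together with the
coordinates of the zero columns, and the remaining sum is at most a full product of squared norms
times 2 to the number of zero columns. That number is at most 2, since connectedness lets two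
adjacent faces determine a kernel vector (`card_kernel_le`). The result is a second moment of at
most 32n² (`Reduced.second_moment_le`).

Truncating the estimator at 32n/ε costs a bias of at most εn and makes it bounded, so a Chernoff
bound gives failure probability 2exp(-ε²N/16) without medians of means (`card_truncated_mean_le`).
Probabilities are rounded to multiples of 2^-m with 2^m ≥ 4F so that fair coins suffice; the
rounding costs a factor of at most 2 in the second moment and no bias. Preparation is cubic because
of the column reduction, and a sample is cheaper than that. The rest is a small program logic that
certifies the program and its step count. -/

/-! ## A program logic with time bounds -/

namespace RealRAM

infixr:67 ";;" => Prog.seq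

/-- `Runs P s B Q`: started in `s`, the program `P` halts within `B` steps in a state satisfying
`Q`. -/
def Runs (P : Prog) (s : State) (B : ℕ) (Q : State → Prop) : Prop :=
  ∃ (t : ℕ) (s' : State), Exec P s t s' ∧ t ≤ B ∧ Q s'

@[simp] theorem State.setN_nreg (s : State) (d n r : ℕ) :
    (s.setN d n).nreg r = if r = d then n else s.nreg r := by
  simp [State.setN, Function.update_apply]

@[simp] theorem State.setN_rreg (s : State) (d n : ℕ) : (s.setN d n).rreg = s.rreg := rfl

@[simp] theorem State.setN_narr (s : State) (d n : ℕ) : (s.setN d n).narr = s.narr := rfl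

@[simp] theorem State.setN_rarr (s : State) (d n : ℕ) : (s.setN d n).rarr = s.rarr := rfl

@[simp] theorem State.setN_coins (s : State) (d n : ℕ) : (s.setN d n).coins = s.coins := rfl

@[simp] theorem State.setR_rreg (s : State) (d r : ℕ) (x : ℝ) :
    (s.setR d x).rreg r = if r = d then x else s.rreg r := by
  simp [State.setR, Function.update_apply]

@[simp] theorem State.setR_nreg (s : State) (d : ℕ) (x : ℝ) : (s.setR d x).nreg = s.nreg := rfl

@[simp] theorem State.setR_narr (s : State) (d : ℕ) (x : ℝ) : (s.setR d x).narr = s.narr := rfl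

@[simp] theorem State.setR_rarr (s : State) (d : ℕ) (x : ℝ) : (s.setR d x).rarr = s.rarr := rfl

@[simp] theorem State.setR_coins (s : State) (d : ℕ) (x : ℝ) : (s.setR d x).coins = s.coins := rfl

/-! ### Footprints -/

/-- The natural registers written by an instruction. -/
def Instr.nregs : Instr → List ℕ
  | nconst d _ | nadd d _ _ | nsub d _ _ | nload d _ _ | flip d => [d]
  | _ => []

/-- The real registers written by an instruction. -/
def Instr.rregs : Instr → List ℕ
  | rconst d _ | radd d _ _ | rsub d _ _ | rmul d _ _ | rdiv d _ _ | rsqrt d _ | rexp d _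
  | rload d _ _ => [d]
  | _ => []

/-- The natural arrays written by an instruction. -/
def Instr.narrs : Instr → List ℕ
  | nstore A _ _ => [A]
  | _ => []

/-- The real arrays written by an instruction. -/
def Instr.rarrs : Instr → List ℕ
  | rstore A _ _ => [A]
  | _ => []

/-- Whether an instruction consumes coins. -/
def Instr.flips : Instr → Bool
  | flip _ => true
  | _ => false

/-- All the instructions occurring in a program. -/
def Prog.instrs : Prog → List Instr
  | skip => []
  | instr i => [i]
  | seq P Q => P.instrs ++ Q.instrs
  | cond _ P Q => P.instrs ++ Q.instrs
  | loop _ P => P.instrs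

/-- The two states agree on everything that the instructions in the list do not write. -/
structure Same (L : List Instr) (s s' : State) : Prop where
  nreg : ∀ r, r ∉ L.flatMap Instr.nregs → s'.nreg r = s.nreg r
  rreg : ∀ r, r ∉ L.flatMap Instr.rregs → s'.rreg r = s.rreg r
  narr : ∀ r, r ∉ L.flatMap Instr.narrs → s'.narr r = s.narr r
  rarr : ∀ r, r ∉ L.flatMap Instr.rarrs → s'.rarr r = s.rarr r
  coins : L.any Instr.flips = false → s'.coins = s.coins

theorem Same.rfl {L : List Instr} {s : State} : Same L s s :=
  ⟨fun _ _ => Eq.refl _, fun _ _ => Eq.refl _, fun _ _ => Eq.refl _, fun _ _ => Eq.refl _,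
    fun _ => Eq.refl _⟩

theorem Same.trans {L : List Instr} {s s' s'' : State} (h : Same L s s') (h' : Same L s' s'') :
    Same L s s'' :=
  ⟨fun r hr => (h'.nreg r hr).trans (h.nreg r hr), fun r hr => (h'.rreg r hr).trans (h.rreg r hr),
    fun r hr => (h'.narr r hr).trans (h.narr r hr), fun r hr => (h'.rarr r hr).trans (h.rarr r hr),
    fun hf => (h'.coins hf).trans (h.coins hf)⟩

theorem Same.mono {L L' : List Instr} {s s' : State} (h : Same L s s') (hL : ∀ i ∈ L, i ∈ L') :
    Same L' s s' := by
  refine ⟨fun r hr => h.nreg r ?_, fun r hr => h.rreg r ?_, fun r hr => h.narr r ?_,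
    fun r hr => h.rarr r ?_, fun hf => h.coins ?_⟩
  all_goals simp only [List.mem_flatMap, not_exists, not_and, List.any_eq_false] at *
  all_goals exact fun i hi => by first | exact hr i (hL i hi) | exact hf i (hL i hi)

theorem Instr.same (i : Instr) (s : State) : Same [i] s (i.apply s) := by
  cases i <;> constructor <;>
    simp +contextual [Instr.apply, Instr.nregs, Instr.rregs, Instr.narrs, Instr.rarrs,
      Instr.flips]

/-- Serves as the frame rule: whatever lies outside the syntactic footprint survives execution, and
membership in the footprint of a concrete program is settled by `decide`. -/
theorem Exec.same {P : Prog} {s s' : State} {t : ℕ} (h : Exec P s t s') : Same P.instrs s s' := by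
  induction h with
  | skip s => exact Same.rfl
  | instr i s => exact i.same s
  | seq _ _ ih ih' =>
    exact (ih.mono fun i hi => List.mem_append_left _ hi).trans
      (ih'.mono fun i hi => List.mem_append_right _ hi)
  | cond_true _ _ ih => exact ih.mono fun i hi => List.mem_append_left _ hi
  | cond_false _ _ ih => exact ih.mono fun i hi => List.mem_append_right _ hi
  | loop_true _ _ _ ih ih' => exact ih.trans ih'
  | loop_false _ => exact Same.rfl

/-! ### Rules -/

/-- The frame fact `Same` is handed over along with the postcondition, here and in `Runs.seq`, so
specifications mention only what a program changes. -/
theorem Runs.mono {P : Prog} {s : State} {B B' : ℕ} {Q Q' : State → Prop} (h : Runs P s B Q)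
    (hB : B ≤ B') (hQ : ∀ s', Q s' → Same P.instrs s s' → Q' s') : Runs P s B' Q' := by
  obtain ⟨t, s', he, ht, hq⟩ := h
  exact ⟨t, s', he, ht.trans hB, hQ s' hq he.same⟩

theorem Runs.seq {P P' : Prog} {s : State} {B B' : ℕ} {Q Q' : State → Prop} (h : Runs P s B Q)
    (h' : ∀ s', Q s' → Same P.instrs s s' → Runs P' s' B' Q') : Runs (P ;; P') s (B + B') Q' := by
  obtain ⟨t, s', he, ht, hq⟩ := h
  obtain ⟨t', s'', he', ht', hq'⟩ := h' s' hq he.same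
  exact ⟨t + t', s'', he.seq he', by omega, hq'⟩

theorem Runs.cond {b : Test} {P P' : Prog} {s : State} {B : ℕ} {Q : State → Prop}
    (h : b.Holds s → Runs P s B Q) (h' : ¬ b.Holds s → Runs P' s B Q) :
    Runs (Prog.cond b P P') s (B + 1) Q := by
  by_cases hb : b.Holds s
  · obtain ⟨t, s', he, ht, hq⟩ := h hb
    exact ⟨t + 1, s', he.cond_true hb, by omega, hq⟩
  · obtain ⟨t, s', he, ht, hq⟩ := h' hb
    exact ⟨t + 1, s', he.cond_false hb, by omega, hq⟩

theorem Runs.skip {s : State} {B : ℕ} {Q : State → Prop} (h : Q s) : Runs Prog.skip s B Q :=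
  ⟨0, s, Exec.skip s, Nat.zero_le _, h⟩

/-- A loop that is executed exactly `N` times. -/
theorem Runs.loop {b : Test} {P : Prog} {s : State} (N B : ℕ) (Inv : ℕ → State → Prop)
    (h0 : Inv 0 s)
    (hstep : ∀ k s', k < N → Same P.instrs s s' → Inv k s' →
      b.Holds s' ∧ Runs P s' B (Inv (k + 1)))
    (hend : ∀ s', Same P.instrs s s' → Inv N s' → ¬ b.Holds s') :
    Runs (Prog.loop b P) s (N * (B + 1) + 1) (Inv N) := by
  suffices H : ∀ n k s', n + k = N → Same P.instrs s s' → Inv k s' →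
      Runs (Prog.loop b P) s' (n * (B + 1) + 1) (Inv N) from H N 0 s rfl Same.rfl h0
  intro n
  induction n with
  | zero =>
    intro k s' hk hs hI
    obtain rfl : k = N := by omega
    exact ⟨1, s', Exec.loop_false (hend s' hs hI), by omega, hI⟩
  | succ n ih =>
    intro k s' hk hs hI
    obtain ⟨hb, t, s'', he, ht, hq⟩ := hstep k s' (by omega) hs hI
    obtain ⟨t', s₃, he', ht', hend⟩ := ih (k + 1) s'' (by omega) (hs.trans he.same) hq
    exact ⟨t + t' + 1, s₃, Exec.loop_true hb he he', by rw [Nat.succ_mul]; omega, hend⟩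

/-- `for i in 0..n do P`, where register `2` holds `1`. -/
def Prog.forLoop (i n : ℕ) (P : Prog) : Prog :=
  Prog.instr (.nconst i 0) ;; Prog.loop (.nlt i n) (P ;; Prog.instr (.nadd i i 2))

/-- The body must establish the invariant in the state with the counter already advanced, because
the increment runs after it. The footprint conditions protect the counter, the bound and the unit in
register `2`. The 2 in `B + 2` pays for test and increment. -/
theorem Runs.forLoop {i n : ℕ} {P : Prog} {s : State} (N B : ℕ) (Inv : ℕ → State → Prop)
    (hi : i ∉ P.instrs.flatMap Instr.nregs)
    (hn : n ∉ (Prog.forLoop i n P).instrs.flatMap Instr.nregs)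
    (h2 : 2 ∉ (Prog.forLoop i n P).instrs.flatMap Instr.nregs)
    (hN : s.nreg n = N) (hone : s.nreg 2 = 1)
    (h0 : Inv 0 (s.setN i 0))
    (hstep : ∀ k s', k < N → Same (Prog.forLoop i n P).instrs s s' → s'.nreg i = k → Inv k s' →
      Runs P s' B (fun s'' => Inv (k + 1) (s''.setN i (k + 1)))) :
    Runs (Prog.forLoop i n P) s (N * (B + 2) + 2) (Inv N) := by
  have h1 : Runs (Prog.instr (.nconst i 0)) s 1 (fun s' => s' = s.setN i 0) :=
    ⟨1, _, Exec.instr _ _, le_rfl, rfl⟩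
  refine (h1.seq (B' := N * (B + 2) + 1)
    (Q' := fun s' => Inv N s') ?_).mono (by omega) (fun _ h _ => h)
  rintro _ rfl hs0
  have hs0' : Same (Prog.forLoop i n P).instrs s (s.setN i 0) :=
    hs0.mono fun _ h => List.mem_append_left _ h
  have key := Runs.loop (b := .nlt i n) (P := P ;; Prog.instr (.nadd i i 2)) (s := s.setN i 0)
    N (B + 1) (fun k s' => Inv k s' ∧ s'.nreg i = k) ⟨h0, by simp⟩ ?_ ?_
  · exact key.mono le_rfl fun _ h _ => h.1
  · rintro k s' hk hs ⟨hI, hik⟩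
    have hs' := hs0'.trans (hs.mono fun _ h => List.mem_append_right _ h)
    refine ⟨?_, ?_⟩
    · simp only [Test.Holds]
      rw [hik, hs'.nreg n hn, hN]
      exact hk
    refine (hstep k s' hk hs' hik hI).seq fun s'' hI' hs'' => ⟨1, _, Exec.instr _ _, le_rfl, ?_⟩
    have e2 : s''.nreg 2 = 1 := by
      rw [(hs'.trans (hs''.mono fun a h => ?_)).nreg 2 h2, hone]
      exact List.mem_append_right _ (List.mem_append_left _ h)
    simp only [Instr.apply]
    rw [hs''.nreg i hi, hik, e2]
    exact ⟨hI', by simp⟩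
  · rintro s' hs ⟨hI, hik⟩
    have hs' := hs0'.trans (hs.mono fun _ h => List.mem_append_right _ h)
    simp only [Test.Holds]
    rw [hik, hs'.nreg n hn, hN]
    exact lt_irrefl _

/-! ### Loop-free programs -/

/-- Whether a program has no loops. -/
def Prog.loopFree : Prog → Bool
  | skip => true
  | instr _ => true
  | seq P Q => P.loopFree && Q.loopFree
  | cond _ P Q => P.loopFree && Q.loopFree
  | loop _ _ => false

open Classical in
/-- The effect of a loop-free program. -/
noncomputable def Prog.eval : Prog → State → State
  | skip, s => s
  | instr i, s => i.apply s
  | seq P Q, s => Q.eval (P.eval s)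
  | cond b P Q, s => if b.Holds s then P.eval s else Q.eval s
  | loop _ _, s => s

/-- A bound for the running time of a loop-free program. -/
def Prog.size : Prog → ℕ
  | skip => 0
  | instr _ => 1
  | seq P Q => P.size + Q.size
  | cond _ P Q => P.size + Q.size + 1
  | loop _ _ => 0

/-- Reduces loop-free code to computation: the postcondition is checked on `P.eval s` by
simplification and the time bound is a closed numeral. -/
theorem Runs.eval {P : Prog} {s : State} {Q : State → Prop} (hP : P.loopFree = true)
    (h : Q (P.eval s)) : Runs P s P.size Q := by
  suffices H : ∀ s, ∃ t, Exec P s t (P.eval s) ∧ t ≤ P.size by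
    obtain ⟨t, he, ht⟩ := H s
    exact ⟨t, _, he, ht, h⟩
  clear h
  induction P with
  | skip => exact fun s => ⟨0, Exec.skip s, le_rfl⟩
  | instr i => exact fun s => ⟨1, Exec.instr i s, le_rfl⟩
  | seq P Q ih ih' =>
    intro s
    simp only [Prog.loopFree, Bool.and_eq_true] at hP
    obtain ⟨t, he, ht⟩ := ih hP.1 s
    obtain ⟨t', he', ht'⟩ := ih' hP.2 (P.eval s)
    exact ⟨t + t', he.seq he', Nat.add_le_add ht ht'⟩
  | cond b P Q ih ih' =>
    intro s
    simp only [Prog.loopFree, Bool.and_eq_true] at hP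
    by_cases hb : b.Holds s
    · obtain ⟨t, he, ht⟩ := ih hP.1 s
      exact ⟨t + 1, by simpa [Prog.eval, hb] using he.cond_true (Q := Q) hb, by
        simp only [Prog.size]; omega⟩
    · obtain ⟨t, he, ht⟩ := ih' hP.2 s
      exact ⟨t + 1, by simpa [Prog.eval, hb] using he.cond_false (P := P) hb, by
        simp only [Prog.size]; omega⟩
  | loop b P => simp [Prog.loopFree] at hP

end RealRAM

/-! ## Column reduction over the field with two elements -/

namespace ColumnReduction

open Finset

/-- The linear map given by the upper left `V × F` block of `A`. -/
def act (V F : ℕ) (A : ℕ → ℕ → ZMod 2) (y : Fin F → ZMod 2) (i : Fin V) : ZMod 2 :=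
  ∑ j : Fin F, A i j * y j

/-- Add column `j` to all the other columns in which row `r` has an entry `1`. -/
def pivotStep (A : ℕ → ℕ → ZMod 2) (r j : ℕ) (i k : ℕ) : ZMod 2 :=
  A i k + A i j * (if k = j then 0 else A r k)

/-- The columns of `A` are self-orthogonal. -/
def Orth (V F : ℕ) (A : ℕ → ℕ → ZMod 2) : Prop :=
  ∀ j < F, ∀ k < F, ∑ i : Fin V, A i j * A i k = 0

/-- `A'` is obtained from `A` by column operations; for every column `j < n` of `A'`, either row
`pv j` is the `j`-th unit vector, or the column vanishes and `pv j = V`. -/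
structure Reduced (V F : ℕ) (A A' : ℕ → ℕ → ZMod 2) (pv : ℕ → ℕ) (n : ℕ) : Prop where
  sum_eq : ∀ h : (Fin V → ZMod 2) → ℝ, ∑ y, h (act V F A y) = ∑ y, h (act V F A' y)
  orth : Orth V F A → Orth V F A'
  pivot : ∀ j < n, (pv j < V ∧ ∀ k < F, A' (pv j) k = if k = j then 1 else 0) ∨
    (pv j = V ∧ ∀ i < V, A' i j = 0)

theorem Reduced.refl (V F : ℕ) (A : ℕ → ℕ → ZMod 2) (pv : ℕ → ℕ) : Reduced V F A A pv 0 :=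
  ⟨fun _ => rfl, id, fun _ h => absurd h (Nat.not_lt_zero _)⟩

/-- The column operation is precomposition with `e`, which adds a linear form in y to the coordinate
j. The form does not involve y_j, so over two elements `e` is an involution and merely permutes the
summation variable. -/
theorem sum_act_pivotStep (V F : ℕ) (A : ℕ → ℕ → ZMod 2) (r : ℕ) (j : Fin F)
    (h : (Fin V → ZMod 2) → ℝ) :
    ∑ y, h (act V F A y) = ∑ y, h (act V F (pivotStep A r j) y) := by
  let v : Fin F → ZMod 2 := fun k => if k = j then 0 else A r k
  let e : (Fin F → ZMod 2) → (Fin F → ZMod 2) := fun y => y + Pi.single j (∑ k, v k * y k)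
  have hv : ∀ (y : Fin F → ZMod 2) (x : ZMod 2),
      ∑ k, v k * (y + Pi.single j x : Fin F → ZMod 2) k = ∑ k, v k * y k := by
    intro y x
    refine sum_congr rfl fun k _ => ?_
    by_cases hk : k = j <;> simp [v, hk]
  have he : Function.Involutive e := by
    intro y
    simp only [e]
    rw [hv, add_assoc, ← Pi.single_add, CharTwo.add_self_eq_zero, Pi.single_zero, add_zero]
  have hact : ∀ y, act V F (pivotStep A r j) y = act V F A (e y) := by
    intro y
    funext i
    simp only [act, pivotStep, e, Pi.add_apply, mul_add, sum_add_distrib, add_mul]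
    congr 1
    rw [sum_eq_single (s := univ) (f := fun k : Fin F => A i k * (Pi.single j _ : Fin F → ZMod 2) k)
      j (fun k _ hk => by simp [hk]) (by simp)]
    simp only [Pi.single_eq_same, mul_sum, mul_assoc, v, Fin.val_inj]
  simp only [hact]
  exact (Equiv.sum_comp he.toPerm (fun y => h (act V F A y))).symm

theorem Orth.pivotStep {V F : ℕ} {A : ℕ → ℕ → ZMod 2} (hA : Orth V F A) (r : ℕ) {j : ℕ}
    (hj : j < F) : Orth V F (pivotStep A r j) := by
  intro k hk l hl
  have : ∀ i : Fin V, ColumnReduction.pivotStep A r j i k * ColumnReduction.pivotStep A r j i l =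
      A i k * A i l + (if l = j then 0 else A r l) * (A i k * A i j) +
      (if k = j then 0 else A r k) * (A i j * A i l) +
      (if k = j then 0 else A r k) * (if l = j then 0 else A r l) * (A i j * A i j) := by
    intro i
    simp only [ColumnReduction.pivotStep]
    ring
  simp only [this, sum_add_distrib, ← mul_sum, hA k hk l hl, hA k hk j hj, hA j hj l hl,
    hA j hj j hj, mul_zero, add_zero]

/-- Earlier unit rows have a 0 in column n, so adding that column elsewhere does not disturb them;
an earlier zero column has a 0 in the pivot row and receives nothing. If column n vanishes the
operation is void, and `r` may then be any row. -/
theorem Reduced.step {V F : ℕ} {A A' : ℕ → ℕ → ZMod 2} {pv : ℕ → ℕ} {n r p : ℕ} (hn : n < F)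
    (h : Reduced V F A A' pv n)
    (hp : (p < V ∧ r = p ∧ A' p n = 1) ∨ (p = V ∧ ∀ i < V, A' i n = 0)) :
    Reduced V F A (pivotStep A' r n) (Function.update pv n p) (n + 1) := by
  refine ⟨fun f => (h.sum_eq f).trans (sum_act_pivotStep V F A' r ⟨n, hn⟩ f),
    fun hA => (h.orth hA).pivotStep r hn, fun j hj => ?_⟩
  have two : ∀ x : ZMod 2, x + x = 0 := CharTwo.add_self_eq_zero
  rcases Nat.lt_succ_iff_lt_or_eq.mp hj with hj | rfl
  · rw [Function.update_of_ne hj.ne]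
    rcases h.pivot j hj with ⟨h1, h2⟩ | ⟨h1, h2⟩
    · refine Or.inl ⟨h1, fun k hk => ?_⟩
      simp [pivotStep, h2 k hk, h2 n hn, hj.ne']
    · refine Or.inr ⟨h1, fun i hi => ?_⟩
      simp only [pivotStep, h2 i hi, hj.ne, if_false, zero_add]
      rcases hp with ⟨hp, rfl, -⟩ | ⟨-, hp⟩
      · simp [h2 r hp]
      · simp [hp i hi]
  · rw [Function.update_self]
    rcases hp with ⟨hp, rfl, hp1⟩ | ⟨rfl, hp⟩
    · refine Or.inl ⟨hp, fun k hk => ?_⟩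
      by_cases hkj : k = j
      · simp [pivotStep, hkj, hp1]
      · simp [pivotStep, hkj, hp1, two]
    · refine Or.inr ⟨rfl, fun i hi => ?_⟩
      simp [pivotStep, hp i hi]

/-! ### Second moments from self-orthogonal columns -/

section Moments

variable {V F : ℕ} {A A' : ℕ → ℕ → ZMod 2} {pv : ℕ → ℕ}

theorem Reduced.act_pivot (h : Reduced V F A A' pv F) {j : Fin F} (hj : pv j < V)
    (y : Fin F → ZMod 2) : act V F A' y ⟨pv j, hj⟩ = y j := by
  rcases h.pivot j j.2 with ⟨-, h2⟩ | ⟨h1, -⟩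
  · simp only [act]
    rw [sum_eq_single j]
    · simp [h2 j j.2]
    · intro k _ hk
      simp [h2 k k.2, Fin.val_inj, hk]
    · simp
  · omega

theorem Reduced.pv_injective (h : Reduced V F A A' pv F) {j k : Fin F} (hj : pv j < V)
    (hjk : pv j = pv k) : j = k := by
  have h1 := h.act_pivot hj (Pi.single j 1)
  have h2 := h.act_pivot (j := k) (hjk ▸ hj) (Pi.single j 1)
  simp only [hjk] at h1
  rw [h1] at h2
  by_contra hne
  rw [Pi.single_eq_same, Pi.single_eq_of_ne (Ne.symm hne)] at h2
  exact one_ne_zero h2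

/-- Pair A'd with column j of A'. The result is 0 by orthogonality. Non-pivot rows contribute
nothing because A'd vanishes there; a pivot row of another column has a 0 in column j; only the
pivot row of j remains, and it contributes d_j. -/
theorem Reduced.eq_zero (h : Reduced V F A A' pv F) (hA : Orth V F A) {d : Fin F → ZMod 2}
    (hd : ∀ j : Fin F, ¬ pv j < V → d j = 0)
    (hact : ∀ a : Fin V, (∀ j : Fin F, pv j ≠ a) → act V F A' d a = 0) : d = 0 := by
  funext j
  by_cases hj : pv j < V
  swap
  · exact hd j hj
  have h0 : ∑ i : Fin V, A' i j * act V F A' d i = 0 := by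
    simp only [act, mul_sum, ← mul_assoc]
    rw [sum_comm]
    simp only [← sum_mul]
    exact sum_eq_zero fun k _ => by rw [h.orth hA j j.2 k k.2, zero_mul]
  rw [sum_eq_single ⟨pv j, hj⟩] at h0
  · rw [h.act_pivot hj] at h0
    rcases h.pivot j j.2 with ⟨-, h2⟩ | ⟨h1, -⟩
    · simpa [h2 j j.2] using h0
    · omega
  · intro i _ hi
    by_cases hex : ∃ k : Fin F, pv k = i
    · obtain ⟨k, hk⟩ := hex
      rcases h.pivot k k.2 with ⟨-, h2⟩ | ⟨h1, -⟩
      · have hne : (j : ℕ) ≠ k := fun e => hi (Fin.ext (by simp [e, hk]))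
        rw [← hk, h2 j j.2, if_neg hne, zero_mul]
      · omega
    · push Not at hex
      rw [hact i hex, mul_zero]
  · simp

/-- The number of vanishing columns is bounded by the dimension of the kernel. -/
theorem Reduced.two_pow_le (h : Reduced V F A A' pv F) {n : ℕ}
    (hker : #{y : Fin F → ZMod 2 | act V F A y = 0} ≤ 2 ^ n) :
    Fintype.card {j : Fin F // ¬ pv j < V} ≤ n := by
  -- For the indicator of 0, invariance of the sum says that A and A' have kernels of equal size.
  have e := h.sum_eq (fun c => if c = 0 then 1 else 0)
  simp only [sum_boole, Nat.cast_inj] at e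
  rw [e] at hker
  have key : Fintype.card ({j : Fin F // ¬ pv j < V} → ZMod 2) ≤
      #{y : Fin F → ZMod 2 | act V F A' y = 0} := by
    -- Extension by zero: a vector supported on the vanishing columns lies in the kernel of A'.
    let f : ({j : Fin F // ¬ pv j < V} → ZMod 2) → Fin F → ZMod 2 :=
      fun z j => if hj : ¬ pv j < V then z ⟨j, hj⟩ else 0
    rw [← card_univ]
    refine card_le_card_of_injOn f (fun z _ => ?_) (fun z _ z' _ hz => ?_)
    · simp only [coe_filter, mem_univ, true_and, Set.mem_ofPred_eq]
      funext i
      refine sum_eq_zero fun j _ => ?_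
      by_cases hj : pv j < V
      · simp [f, hj]
      · rcases h.pivot j j.2 with ⟨h1, -⟩ | ⟨-, h2⟩
        · exact absurd h1 hj
        · simp [h2 i i.2]
    · funext ⟨j, hj⟩
      have := congrFun hz j
      simpa only [f, dif_pos hj] using this
  rw [Fintype.card_fun, ZMod.card] at key
  exact (Nat.pow_le_pow_iff_right (by norm_num)).mp (key.trans hker)

/-- Squared Euclidean norm of a pair of weights. -/
def normSq (w : ZMod 2 → ℝ) : ℝ := ∑ x, w x ^ 2

theorem normSq_nonneg (w : ZMod 2 → ℝ) : 0 ≤ normSq w := sum_nonneg fun _ _ => sq_nonneg _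

/-- By `Reduced.eq_zero`, y is determined by its zero-column coordinates and the non-pivot rows of
A'y. Summing over all such data instead of the image only adds nonnegative terms, and then the sum
factorises over the rows. -/
theorem sum_prod_le (h : Reduced V F A A' pv F) (hA : Orth V F A)
    (w : ℕ → ZMod 2 → ℝ) :
    ∑ y : Fin F → ZMod 2, ∏ a : {a : Fin V // ∀ j : Fin F, pv j ≠ a}, w a (act V F A' y a) ^ 2 ≤
      2 ^ Fintype.card {j : Fin F // ¬ pv j < V} *
        ∏ a : {a : Fin V // ∀ j : Fin F, pv j ≠ a}, normSq (w a) := by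
  classical
  let I := {a : Fin V // ∀ j : Fin F, pv j ≠ a}
  let Z := {j : Fin F // ¬ pv j < V}
  let ρ : (Fin F → ZMod 2) → (Z → ZMod 2) × (I → ZMod 2) :=
    fun y => (fun j => y j, fun a => act V F A' y a)
  have hρ : Function.Injective ρ := by
    intro y y' hy
    rw [← sub_eq_zero]
    refine h.eq_zero hA (fun j hj => ?_) (fun a ha => ?_)
    · have := congrFun (congrArg Prod.fst hy) ⟨j, hj⟩
      simpa [sub_eq_zero] using this
    · have : act V F A' y a = act V F A' y' a := congrFun (congrArg Prod.snd hy) ⟨a, ha⟩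
      simp only [act, Pi.sub_apply, mul_sub, sum_sub_distrib, sub_eq_zero] at *
      exact this
  have hnn : ∀ c : (Z → ZMod 2) × (I → ZMod 2), 0 ≤ ∏ a : I, w a (c.2 a) ^ 2 :=
    fun c => prod_nonneg fun a _ => sq_nonneg _
  calc ∑ y : Fin F → ZMod 2, ∏ a : I, w a (act V F A' y a) ^ 2
      = ∑ c ∈ univ.map ⟨ρ, hρ⟩, ∏ a : I, w a (c.2 a) ^ 2 := by rw [sum_map]; rfl
    _ ≤ ∑ c : (Z → ZMod 2) × (I → ZMod 2), ∏ a : I, w a (c.2 a) ^ 2 :=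
        sum_le_sum_of_subset_of_nonneg (subset_univ _) fun c _ _ => hnn c
    _ = _ := by
        rw [Fintype.sum_prod_type]
        simp only [sum_const, card_univ, Fintype.card_fun, ZMod.card, nsmul_eq_mul, normSq]
        rw [prod_univ_sum, Fintype.piFinset_univ]
        push_cast
        rfl

/-- The second moment of the importance-sampling estimator. -/
theorem Reduced.second_moment_le (h : Reduced V F A A' pv F) (hA : Orth V F A)
    (hker : #{y : Fin F → ZMod 2 | act V F A y = 0} ≤ 2 ^ 2)
    {w : ℕ → ZMod 2 → ℝ} (hw : ∀ a x, 0 < w a x) (hwV : ∀ x, w V x = 1)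
    {G : ℕ → ZMod 2 → ℝ} {κ : ℝ} (hG0 : ∀ j < F, ∀ x, 0 ≤ G j x) (hκ : κ ^ F ≤ 2)
    (hG : ∀ j < F, ∀ x, G j x ≤ κ * (normSq (w (pv j)) / w (pv j) x ^ 2)) :
    ∑ y : Fin F → ZMod 2, (∏ j : Fin F, G j (y j)) * (∏ a : Fin V, w a (act V F A' y a)) ^ 2 ≤
      32 * ∏ a : Fin V, normSq (w a) := by
  classical
  let n0 := Fintype.card {j : Fin F // ¬ pv j < V}
  have hn0 : n0 ≤ 2 := h.two_pow_le hker
  have hpos : ∀ a, 0 < normSq (w a) := fun a => sum_pos (fun x _ => pow_pos (hw a x) 2) (by simp)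
  have hnormV : normSq (w V) = 2 := by simp [normSq, hwV]
  have hpvV : ∀ j : Fin F, ¬ pv j < V → pv j = V := fun j hj => by
    rcases h.pivot j j.2 with ⟨h1, -⟩ | ⟨h1, -⟩
    · exact absurd h1 hj
    · exact h1
  -- a product over all vertices splits into pivot rows and the other rows
  have hsplit : ∀ f : ℕ → ℝ, ∏ a : Fin V, f a =
      (∏ j : {j : Fin F // pv j < V}, f (pv j)) *
        ∏ a : {a : Fin V // ∀ j : Fin F, pv j ≠ a}, f a := by
    intro f
    rw [← Fintype.prod_subtype_mul_prod_subtype (fun a : Fin V => ¬ ∀ j : Fin F, pv j ≠ a)]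
    congr 1
    · refine (Fintype.prod_bijective
        (fun j : {j : Fin F // pv j < V} => (⟨⟨pv j, j.2⟩, fun hh => hh j rfl⟩ :
          {a : Fin V // ¬ ∀ j : Fin F, pv j ≠ a})) ⟨?_, ?_⟩ _ _ fun _ => rfl).symm
      · intro j k hjk
        simp only [Subtype.mk.injEq, Fin.mk.injEq] at hjk
        exact Subtype.ext (h.pv_injective j.2 hjk)
      · rintro ⟨a, ha⟩
        push Not at ha
        obtain ⟨j, hj⟩ := ha
        exact ⟨⟨j, hj ▸ a.2⟩, Subtype.ext (Fin.ext hj)⟩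
    · exact Fintype.prod_equiv (Equiv.subtypeEquivRight fun a => by simp) _ _ fun _ => rfl
  have hterm : ∀ y : Fin F → ZMod 2,
      (∏ j : Fin F, G j (y j)) * (∏ a : Fin V, w a (act V F A' y a)) ^ 2 ≤
        2 * 2 ^ n0 * (∏ j : {j : Fin F // pv j < V}, normSq (w (pv j))) *
          ∏ a : {a : Fin V // ∀ j : Fin F, pv j ≠ a}, w a (act V F A' y a) ^ 2 := by
    intro y
    have hsp := hsplit (fun a => if ha : a < V then w a (act V F A' y ⟨a, ha⟩) ^ 2 else 1)
    simp only [Fin.is_lt, dif_pos, Fin.eta] at hsp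
    have e1 : ∀ j : {j : Fin F // pv j < V},
        (if ha : pv j < V then w (pv j) (act V F A' y ⟨pv j, ha⟩) ^ 2 else 1) =
          w (pv j) (y j) ^ 2 := by
      intro j
      rw [dif_pos j.2, h.act_pivot j.2]
    simp only [e1] at hsp
    -- The factor 2 pays for the rounding of all F probabilities. A zero column points to the dummy
    -- vertex V, whose weights are 1 and whose squared norm is 2; together these give 2^n0.
    have hprod : ∏ j : Fin F, G j (y j) ≤
        2 * ((∏ j : {j : Fin F // pv j < V}, normSq (w (pv j)) / w (pv j) (y j) ^ 2) * 2 ^ n0) := by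
      calc ∏ j : Fin F, G j (y j)
          ≤ ∏ j : Fin F, κ * (normSq (w (pv j)) / w (pv j) (y j) ^ 2) :=
            prod_le_prod (fun j _ => hG0 j j.2 _) fun j _ => hG j j.2 _
        _ = κ ^ F * ∏ j : Fin F, normSq (w (pv j)) / w (pv j) (y j) ^ 2 := by
            rw [prod_mul_distrib]; simp
        _ ≤ 2 * ∏ j : Fin F, normSq (w (pv j)) / w (pv j) (y j) ^ 2 := by
            refine mul_le_mul_of_nonneg_right hκ (prod_nonneg fun j _ => ?_)
            exact div_nonneg (hpos _).le (sq_nonneg _)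
        _ = _ := by
            rw [← Fintype.prod_subtype_mul_prod_subtype (fun j : Fin F => pv j < V)]
            congr 2
            rw [prod_congr rfl (g := fun _ => (2 : ℝ))]
            · rw [prod_const, card_univ]
            · rintro ⟨j, hj⟩ -
              simp [hpvV j hj, hnormV, hwV]
    rw [← prod_pow, hsp]
    calc _ ≤ 2 * ((∏ j : {j : Fin F // pv j < V}, normSq (w (pv j)) / w (pv j) (y j) ^ 2) *
              2 ^ n0) * ((∏ j : {j : Fin F // pv j < V}, w (pv j) (y j) ^ 2) *
              ∏ a : {a : Fin V // ∀ j : Fin F, pv j ≠ a}, w a (act V F A' y a) ^ 2) :=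
          mul_le_mul_of_nonneg_right hprod (mul_nonneg (prod_nonneg fun _ _ => sq_nonneg _)
            (prod_nonneg fun _ _ => sq_nonneg _))
      _ = 2 * 2 ^ n0 * (∏ j : {j : Fin F // pv j < V},
            normSq (w (pv j)) / w (pv j) (y j) ^ 2 * w (pv j) (y j) ^ 2) *
              ∏ a : {a : Fin V // ∀ j : Fin F, pv j ≠ a}, w a (act V F A' y a) ^ 2 := by
          rw [prod_mul_distrib]; ring
      _ = _ := by
          congr 2
          refine prod_congr rfl fun j _ => div_mul_cancel₀ _ (pow_pos (hw _ _) 2).ne'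
  have hPnn : 0 ≤ ∏ j : {j : Fin F // pv j < V}, normSq (w (pv j)) :=
    prod_nonneg fun _ _ => (hpos _).le
  have hInn : 0 ≤ ∏ a : {a : Fin V // ∀ j : Fin F, pv j ≠ a}, normSq (w a) :=
    prod_nonneg fun _ _ => (hpos _).le
  -- The constant 32 is 2·4·4: rounding, the sampling of the zero columns, and the summation over
  -- their coordinates.
  have h4 : (2 : ℝ) * 2 ^ n0 * 2 ^ n0 ≤ 32 := by
    have : (2 : ℝ) ^ n0 ≤ 2 ^ 2 := pow_le_pow_right₀ (by norm_num) hn0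
    nlinarith [pow_pos (show (0 : ℝ) < 2 by norm_num) n0]
  calc _ ≤ ∑ y : Fin F → ZMod 2, 2 * 2 ^ n0 *
          (∏ j : {j : Fin F // pv j < V}, normSq (w (pv j))) *
          ∏ a : {a : Fin V // ∀ j : Fin F, pv j ≠ a}, w a (act V F A' y a) ^ 2 :=
        sum_le_sum fun y _ => hterm y
    _ ≤ 2 * 2 ^ n0 * (∏ j : {j : Fin F // pv j < V}, normSq (w (pv j))) * (2 ^ n0 *
          ∏ a : {a : Fin V // ∀ j : Fin F, pv j ≠ a}, normSq (w a)) := by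
        rw [← mul_sum]
        exact mul_le_mul_of_nonneg_left (sum_prod_le h hA w) (by positivity)
    _ = (2 * 2 ^ n0 * 2 ^ n0) * ∏ a : Fin V, normSq (w a) := by
        rw [hsplit fun a => normSq (w a)]; ring
    _ ≤ _ := mul_le_mul_of_nonneg_right h4 (prod_nonneg fun _ _ => (hpos _).le)

end Moments

end ColumnReduction

/-! ## The program -/

namespace RealRAM

open Finset ColumnReduction

/-- Straight-line programs. -/
def Prog.block : List Instr → Prog
  | [] => skip
  | i :: l => instr i ;; block l

theorem Runs.evalLE {P : Prog} {s : State} {B : ℕ} {Q : State → Prop}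
    (hP : P.loopFree = true ∧ P.size ≤ B) (h : Q (P.eval s)) : Runs P s B Q :=
  (Runs.eval hP.1 h).mono hP.2 fun _ h _ => h

attribute [local simp] Prog.block Prog.eval Instr.apply Test.Holds Function.update_apply

open Prog

/-! ### Powers of two -/

/-- Set up constants, and the least power of two (register `3`) that is at least `4 * F`. -/
def setupProg : Prog :=
  block [.nconst 2 1, .rconst 3 1, .nadd 5 1 1, .nadd 5 5 5, .nconst 3 1, .rconst 4 1] ;;
  loop (.nlt 3 5) (block [.nadd 3 3 3, .radd 4 4 4])

theorem runs_setup {s : State} {F : ℕ} (hF : s.nreg 1 = F) :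
    Runs setupProg s (6 + (Nat.clog 2 (4 * F) * 3 + 1)) (fun s' => s'.nreg 2 = 1 ∧
      s'.rreg 3 = 1 ∧ s'.nreg 3 = 2 ^ Nat.clog 2 (4 * F) ∧
      s'.rreg 4 = 2 ^ Nat.clog 2 (4 * F)) := by
  refine Runs.seq (Q := fun s' => s'.nreg 2 = 1 ∧ s'.rreg 3 = 1 ∧ s'.nreg 5 = 4 * F ∧
    s'.nreg 3 = 1 ∧ s'.rreg 4 = 1) (Runs.evalLE (by decide) ?_) ?_
  · simp [hF]
    omega
  rintro s' ⟨h2, h3, h5, h3', h4⟩ -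
  refine (Runs.loop (Nat.clog 2 (4 * F)) 2 (fun k t => t.nreg 3 = 2 ^ k ∧ t.rreg 4 = 2 ^ k) ?_ ?_
    ?_).mono le_rfl ?_
  · simp [h3', h4]
  · rintro k t hk hs ⟨ha, hb⟩
    refine ⟨?_, Runs.evalLE (by decide) ?_⟩
    · simp only [Test.Holds, ha, hs.nreg 5 (by decide), h5]
      exact (Nat.lt_clog_iff_pow_lt (by norm_num)).mp hk
    · simp [ha, hb, pow_succ, mul_two]
  · rintro t hs ⟨ha, hb⟩
    simp only [Test.Holds, ha, hs.nreg 5 (by decide), h5]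
    rw [← Nat.lt_clog_iff_pow_lt (by norm_num)]
    exact lt_irrefl _
  · rintro t ⟨ha, hb⟩ hs
    exact ⟨(hs.nreg 2 (by decide)).trans h2, (hs.rreg 3 (by decide)).trans h3, ha, hb⟩

/-! ### Vertex weights -/

/-- The Boltzmann weight of a vertex whose spin product is `(-1) ^ x`. -/
noncomputable def weight (β : ℝ) (J : ℕ → ℝ) (a : ℕ) (x : ZMod 2) : ℝ :=
  if x = 0 then Real.exp (J a * β) else Real.exp (-(J a * β))

theorem normSq_eq (w : ZMod 2 → ℝ) : normSq w = w 0 ^ 2 + w 1 ^ 2 :=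
  Fin.sum_univ_two fun x => w x ^ 2

/-- Compute the vertex weights (arrays `1`, `2`) and their squared norm (register `5`). -/
def weightsProg : Prog :=
  block [.rconst 5 1] ;;
  Prog.forLoop 7 0 (block [.rload 6 0 7, .rmul 6 6 0, .rexp 7 6, .rsub 8 9 6, .rexp 8 8, .rstore 1 7 7,
    .rstore 2 7 8, .rmul 7 7 7, .rmul 8 8 8, .radd 7 7 8, .rmul 5 5 7]) ;;
  block [.rstore 1 0 3, .rstore 2 0 3]

/-- The extra entry at index V is a dummy vertex with both weights 1. Zero columns use it as their
pivot, so their coordinates are drawn as nearly fair bits without a special case. Real register `9`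
stays 0 and serves for negation. -/
theorem runs_weights {s : State} {V : ℕ} {β : ℝ} {J : ℕ → ℝ} (hV : s.nreg 0 = V)
    (h2 : s.nreg 2 = 1) (hβ : s.rreg 0 = β) (h3 : s.rreg 3 = 1) (h9 : s.rreg 9 = 0)
    (hJ : s.rarr 0 = J) (hJV : J V = 0) :
    Runs weightsProg s (1 + ((V * (11 + 2) + 2) + 2)) (fun s' =>
      (∀ a ≤ V, s'.rarr 1 a = weight β J a 0 ∧ s'.rarr 2 a = weight β J a 1) ∧
      s'.rreg 5 = ∏ a ∈ range V, normSq (weight β J a)) := by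
  refine Runs.seq (Q := fun s' => s'.rreg 5 = 1) (Runs.evalLE (by decide) (by simp)) ?_
  intro s1 h5 hs1
  refine Runs.seq (Runs.forLoop V 11 (fun k t =>
    (∀ a < k, t.rarr 1 a = weight β J a 0 ∧ t.rarr 2 a = weight β J a 1) ∧
      t.rreg 5 = ∏ a ∈ range k, normSq (weight β J a)) (by decide) (by decide) (by decide)
      ((hs1.nreg 0 (by decide)).trans hV) ((hs1.nreg 2 (by decide)).trans h2) ?_ ?_) ?_
  · simp [h5]
  · rintro k t hk hs hi ⟨ha, hb⟩
    refine Runs.evalLE (by decide) ⟨?_, ?_⟩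
    · intro a hak
      rcases Nat.lt_succ_iff_lt_or_eq.mp hak with hak | rfl
      · simpa [hi, hak.ne] using ha a hak
      · simp [hi, weight, hs.rreg 0 (by decide), hs.rreg 9 (by decide), hs1.rreg 0 (by decide),
          hs1.rreg 9 (by decide), hβ, h9, hs.rarr 0 (by decide), hs1.rarr 0 (by decide), hJ]
    · simp [hi, hs.rreg 0 (by decide), hs.rreg 9 (by decide), hs1.rreg 0 (by decide),
          hs1.rreg 9 (by decide), hβ, h9, hs.rarr 0 (by decide), hs1.rarr 0 (by decide), hJ,
          prod_range_succ, hb, normSq_eq, weight, sq]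
  · rintro t ⟨ha, hb⟩ hs
    refine Runs.evalLE (by decide) ⟨?_, ?_⟩
    · intro a hav
      rcases Nat.lt_or_eq_of_le hav with hav | rfl
      · simpa [hs.nreg 0 (by decide), hs1.nreg 0 (by decide), hV, hav.ne] using ha a hav
      · simp [hs.nreg 0 (by decide), hs1.nreg 0 (by decide), hV, hs.rreg 3 (by decide),
          hs1.rreg 3 (by decide), h3, weight, hJV]
    · simpa using hb

/-! ### Column reduction -/

/-- Array `0` holds the matrix `A` row by row. -/
def Holds (V F : ℕ) (A : ℕ → ℕ → ZMod 2) (s : State) : Prop :=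
  ∀ i < V, ∀ j < F, s.narr 0 (i * F + j) = (A i j).val

theorem Holds.congr {V F : ℕ} {A A' : ℕ → ℕ → ZMod 2} {s s' : State} (h : Holds V F A s)
    (hA : ∀ i < V, ∀ j < F, A i j = A' i j) (hs : s'.narr 0 = s.narr 0) : Holds V F A' s' := by
  intro i hi j hj
  rw [hs, h i hi j hj, hA i hi j hj]

theorem index_inj {F i j i' j' : ℕ} (hj : j < F) (hj' : j' < F) :
    i * F + j = i' * F + j' ↔ i = i' ∧ j = j' := by
  refine ⟨fun h => ?_, by rintro ⟨rfl, rfl⟩; rfl⟩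
  have hF : 0 < F := by omega
  have h1 : (i * F + j) / F = i := by
    rw [mul_comm, Nat.mul_add_div hF, Nat.div_eq_of_lt hj, add_zero]
  have h2 : (i' * F + j') / F = i' := by
    rw [mul_comm, Nat.mul_add_div hF, Nat.div_eq_of_lt hj', add_zero]
  have : i = i' := by rw [← h1, h, h2]
  subst this
  exact ⟨rfl, by omega⟩

theorem Holds.store {V F : ℕ} {A : ℕ → ℕ → ZMod 2} {s s' : State} (h : Holds V F A s)
    {i j : ℕ} {x : ZMod 2} (hj : j < F)
    (hs : s'.narr 0 = Function.update (s.narr 0) (i * F + j) x.val) :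
    Holds V F (fun i' j' => if i' = i ∧ j' = j then x else A i' j') s' := by
  intro i' hi' j' hj'
  rw [hs, Function.update_apply]
  simp only [index_inj hj' hj]
  split_ifs
  · rfl
  · exact h i' hi' j' hj'

theorem zmod_two_cases (x : ZMod 2) : x = 0 ∨ x = 1 := by
  revert x; decide

/-- Truncated subtraction from 1 is how the machine adds 1 modulo 2. -/
theorem one_sub_val (x : ZMod 2) : 1 - x.val = (x + 1).val := by
  revert x; decide

theorem val_eq_one_iff (x : ZMod 2) : x.val = 1 ↔ x = 1 := by
  revert x; decide

/-- Add column `r6` to column `r8`. -/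
def addColumnProg : Prog :=
  block [.nconst 9 0] ;;
  Prog.forLoop 7 0 (block [.nadd 10 9 6, .nload 12 0 10] ;;
    Prog.cond (.neq 12 2)
      (block [.nadd 10 9 8, .nload 12 0 10, .nsub 12 2 12, .nstore 0 10 12]) skip ;;
    block [.nadd 9 9 1])

theorem runs_addColumn {s : State} {V F j j' : ℕ} {A : ℕ → ℕ → ZMod 2} (hV : s.nreg 0 = V)
    (hF : s.nreg 1 = F) (h2 : s.nreg 2 = 1) (h6 : s.nreg 6 = j) (h8 : s.nreg 8 = j')
    (hj : j < F) (hj' : j' < F) (hne : j ≠ j') (hA : Holds V F A s) :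
    Runs addColumnProg s (1 + (V * (8 + 2) + 2))
      (Holds V F fun i k => if k = j' then A i k + A i j else A i k) := by
  refine Runs.seq (Q := fun s' => s'.nreg 9 = 0 ∧ Holds V F A s') (Runs.evalLE (by decide)
    ⟨by simp, hA.congr (fun _ _ _ _ => rfl) (by simp)⟩) ?_
  rintro s1 ⟨h9, hA1⟩ hs1
  refine (Runs.forLoop V 8 (fun n t => t.nreg 9 = n * F ∧
    Holds V F (fun i k => if k = j' ∧ i < n then A i k + A i j else A i k) t)
    (by decide) (by decide) (by decide)
    ((hs1.nreg 0 (by decide)).trans hV) ((hs1.nreg 2 (by decide)).trans h2) ?_ ?_).mono le_rfl ?_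
  · exact ⟨by simp [h9], hA1.congr (by simp) (by simp)⟩
  · rintro k t hk hs hi ⟨ha, hb⟩
    have e1 : t.nreg 1 = F := by rw [hs.nreg 1 (by decide), hs1.nreg 1 (by decide), hF]
    have e2 : t.nreg 2 = 1 := by rw [hs.nreg 2 (by decide), hs1.nreg 2 (by decide), h2]
    have e6 : t.nreg 6 = j := by rw [hs.nreg 6 (by decide), hs1.nreg 6 (by decide), h6]
    have e8 : t.nreg 8 = j' := by rw [hs.nreg 8 (by decide), hs1.nreg 8 (by decide), h8]
    have x1 := hb k hk j hj
    have x2 := hb k hk j' hj'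
    simp only [hne, false_and, if_false] at x1
    simp only [lt_irrefl, and_false, if_false] at x2
    refine Runs.evalLE (by decide) ⟨?_, ?_⟩
    · by_cases hx : A k j = 1 <;>
        simp [ha, e1, e2, e6, x1, val_eq_one_iff, hx, Nat.succ_mul]
    · by_cases hx : A k j = 1
      · refine (hb.store (s' := _) (i := k) (j := j') (x := A k j' + 1) hj' ?_).congr ?_ rfl
        · simp [ha, e2, e6, e8, x1, x2, hx, one_sub_val, ZMod.val_one]
        · intro i hiV l hl
          by_cases hik : i = k <;> by_cases hlj : l = j'
          · simp [hik, hlj, hx]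
          · simp [hlj]
          · simp [hlj, hik, le_iff_lt_or_eq]
          · simp [hlj]
      · refine hb.congr ?_ (by simp [ha, e2, e6, x1, val_eq_one_iff, hx])
        intro i hiV l hl
        have h0 : A k j = 0 := (zmod_two_cases _).resolve_right hx
        by_cases hik : i = k
        · simp [hik, h0]
        · simp [hik, le_iff_lt_or_eq]
  · rintro t ⟨-, hb⟩ -
    exact hb.congr (fun i hi j hj => by simp [hi]) rfl

/-- Find a row (register `13`, offset in register `14`) with an entry `1` in column `r6`. -/
def findPivotProg : Prog :=
  block [.nadd 13 0 22, .nconst 14 0, .nconst 9 0] ;;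
  Prog.forLoop 7 0 (block [.nadd 10 9 6, .nload 11 0 10] ;;
    Prog.cond (.neq 11 2) (block [.nadd 13 7 22, .nadd 14 9 22]) skip ;; block [.nadd 9 9 1])

/-- Register `22` holds 0, so adding it copies a register. The value V in register `13` signals a
vanishing column; the offset then remains that of row 0, which exists when V is positive, so the
clearing step can run unconditionally and has no effect. -/
theorem runs_findPivot {s : State} {V F j : ℕ} {A : ℕ → ℕ → ZMod 2} (hV : s.nreg 0 = V)
    (hF : s.nreg 1 = F) (h2 : s.nreg 2 = 1) (h22 : s.nreg 22 = 0) (h6 : s.nreg 6 = j)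
    (hj : j < F) (hA : Holds V F A s) :
    Runs findPivotProg s (3 + (V * (6 + 2) + 2)) (fun s' => ∃ r, s'.nreg 14 = r * F ∧
      (0 < V → r < V) ∧
      ((s'.nreg 13 < V ∧ r = s'.nreg 13 ∧ A (s'.nreg 13) j = 1) ∨
        (s'.nreg 13 = V ∧ ∀ i < V, A i j = 0))) := by
  refine Runs.seq (Q := fun s' => s'.nreg 9 = 0 ∧ s'.nreg 13 = V ∧ s'.nreg 14 = 0)
    (Runs.evalLE (by decide) (by simp [hV, h22])) ?_
  rintro s1 ⟨h9, h13, h14⟩ hs1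
  refine (Runs.forLoop V 6 (fun n t => t.nreg 9 = n * F ∧ ∃ r, t.nreg 14 = r * F ∧
      (0 < V → r < V) ∧
      ((t.nreg 13 < V ∧ r = t.nreg 13 ∧ A (t.nreg 13) j = 1) ∨
        (t.nreg 13 = V ∧ ∀ i < n, A i j = 0)))
    (by decide) (by decide) (by decide)
    ((hs1.nreg 0 (by decide)).trans hV) ((hs1.nreg 2 (by decide)).trans h2) ?_ ?_).mono le_rfl ?_
  · exact ⟨by simp [h9], 0, by simp [h14], id, Or.inr (by simp [h13])⟩
  · rintro k t hk hs hi ⟨ha, hb⟩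
    have e1 : t.nreg 1 = F := by rw [hs.nreg 1 (by decide), hs1.nreg 1 (by decide), hF]
    have e2 : t.nreg 2 = 1 := by rw [hs.nreg 2 (by decide), hs1.nreg 2 (by decide), h2]
    have e6 : t.nreg 6 = j := by rw [hs.nreg 6 (by decide), hs1.nreg 6 (by decide), h6]
    have e22 : t.nreg 22 = 0 := by rw [hs.nreg 22 (by decide), hs1.nreg 22 (by decide), h22]
    have x1 : t.narr 0 (k * F + j) = (A k j).val := by
      rw [hs.narr 0 (by decide), hs1.narr 0 (by decide), hA k hk j hj]
    refine Runs.evalLE (by decide) ?_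
    by_cases hx : A k j = 1
    · exact ⟨by simp [ha, e1, e2, e6, x1, val_eq_one_iff, hx, Nat.succ_mul], k,
        by simp [ha, e2, e6, x1, val_eq_one_iff, hx, e22], fun _ => hk,
        Or.inl (by simp [ha, e2, e6, x1, val_eq_one_iff, hx, e22, hi, hk])⟩
    · obtain ⟨r, hr, hrV, hb⟩ := hb
      refine ⟨by simp [ha, e1, e2, e6, x1, val_eq_one_iff, hx, Nat.succ_mul], r,
        by simp [ha, e2, e6, x1, val_eq_one_iff, hx, hr], hrV, hb.imp ?_ ?_⟩
      · rintro ⟨b1, b2, b3⟩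
        simpa [ha, e2, e6, x1, val_eq_one_iff, hx, b1, b3] using b2
      · rintro ⟨b1, b2⟩
        refine ⟨by simp [ha, e2, e6, x1, val_eq_one_iff, hx, b1], fun i hik => ?_⟩
        rcases Nat.lt_succ_iff_lt_or_eq.mp hik with hik | rfl
        · exact b2 i hik
        · exact (zmod_two_cases _).resolve_right hx
  · rintro t ⟨-, hb⟩ -
    exact hb

/-- Clear the row with offset `r14` using column `r6`. -/
def clearRowProg : Prog :=
  Prog.forLoop 8 1 (Prog.cond (.neq 8 6) skip
    (block [.nadd 10 14 8, .nload 11 0 10] ;; Prog.cond (.neq 11 2) addColumnProg skip))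

theorem runs_clearRow {s : State} {V F j r : ℕ} {A : ℕ → ℕ → ZMod 2} (hV : s.nreg 0 = V)
    (hF : s.nreg 1 = F) (h2 : s.nreg 2 = 1) (h6 : s.nreg 6 = j) (h14 : s.nreg 14 = r * F)
    (hr : r < V) (hj : j < F) (hA : Holds V F A s) :
    Runs clearRowProg s (F * ((2 + ((1 + (V * (8 + 2) + 2)) + 1) + 1) + 2) + 2)
      (Holds V F (pivotStep A r j)) := by
  refine (Runs.forLoop F (2 + ((1 + (V * (8 + 2) + 2)) + 1) + 1) (fun n t =>
    Holds V F (fun i k => if k < n then pivotStep A r j i k else A i k) t)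
    (by decide) (by decide) (by decide) hF h2 ?_ ?_).mono le_rfl ?_
  · exact hA.congr (by simp) (by simp)
  · rintro k t hk hs hi hb
    have e0 : t.nreg 0 = V := by rw [hs.nreg 0 (by decide), hV]
    have e1 : t.nreg 1 = F := by rw [hs.nreg 1 (by decide), hF]
    have e2 : t.nreg 2 = 1 := by rw [hs.nreg 2 (by decide), h2]
    have e6 : t.nreg 6 = j := by rw [hs.nreg 6 (by decide), h6]
    have e14 : t.nreg 14 = r * F := by rw [hs.nreg 14 (by decide), h14]
    -- Column k has not been treated yet, so the entry read in row r is still the original one.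
    have x1 := hb r hr k hk
    simp only [lt_irrefl, if_false] at x1
    have hskip : ∀ i l, (k = j ∨ A r k = 0) →
        (if l < k then pivotStep A r j i l else A i l) =
          if l < k + 1 then pivotStep A r j i l else A i l := by
      intro i l hkj
      by_cases hl : l = k
      · subst hl
        rcases hkj with rfl | h0
        · simp [pivotStep]
        · simp [pivotStep, h0]
      · simp [le_iff_lt_or_eq, hl]
    refine Runs.cond (fun hkj => Runs.skip ?_) (fun hkj => ?_)
    · simp only [Test.Holds, hi, e6] at hkj
      exact hb.congr (fun i _ l _ => hskip i l (Or.inl hkj)) (by simp)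
    · simp only [Test.Holds, hi, e6] at hkj
      refine Runs.seq (Q := fun s' => s'.nreg 11 = (A r k).val)
        (Runs.evalLE (by decide) (by simp [e14, hi, x1])) ?_
      intro t' h11 ht'
      have hb' := hb.congr (fun _ _ _ _ => rfl) (ht'.narr 0 (by decide))
      have e2' : t'.nreg 2 = 1 := by rw [ht'.nreg 2 (by decide), e2]
      refine Runs.cond (fun hx => ?_) (fun hx => Runs.skip ?_)
      · simp only [Test.Holds, h11, e2', val_eq_one_iff] at hx
        refine (runs_addColumn (j := j) (j' := k) (by rw [ht'.nreg 0 (by decide), e0])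
          (by rw [ht'.nreg 1 (by decide), e1]) e2' (by rw [ht'.nreg 6 (by decide), e6])
          (by rw [ht'.nreg 8 (by decide), hi]) hj hk (Ne.symm hkj) hb').mono le_rfl ?_
        intro t'' hb'' _
        refine hb''.congr ?_ (by simp)
        intro i _ l _
        by_cases hl : l = k
        · subst hl
          simp only [if_true, lt_irrefl, if_false, Nat.lt_succ_self, pivotStep, hkj, hx, mul_one]
          -- Column j is fixed by `pivotStep`, so it reads the same whether or not its turn has
          -- passed.
          split_ifs <;> simp
        · simp [le_iff_lt_or_eq, hl]
      · simp only [Test.Holds, h11, e2', val_eq_one_iff] at hx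
        exact hb'.congr (fun i _ l _ => hskip i l
          (Or.inr ((zmod_two_cases _).resolve_right hx))) (by simp)
  · intro t hb _
    exact hb.congr (fun i hi j hj => by simp [hj]) rfl

/-- Column reduction; the pivot rows are stored in array `1`. -/
def reduceProg : Prog :=
  Prog.forLoop 6 1 (findPivotProg ;; clearRowProg ;; block [.nstore 1 6 13])

theorem runs_reduce {s : State} {V F : ℕ} {A : ℕ → ℕ → ZMod 2} (hV : s.nreg 0 = V)
    (hF : s.nreg 1 = F) (h2 : s.nreg 2 = 1) (h22 : s.nreg 22 = 0) (hVpos : 0 < V)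
    (hA : Holds V F A s) :
    Runs reduceProg s (F * (((3 + (V * (6 + 2) + 2)) +
      ((F * ((2 + ((1 + (V * (8 + 2) + 2)) + 1) + 1) + 2) + 2) + 1)) + 2) + 2)
      (fun s' => ∃ A', Holds V F A' s' ∧ Reduced V F A A' (s'.narr 1) F) := by
  refine Runs.forLoop F _ (fun n t => ∃ A', Holds V F A' t ∧ Reduced V F A A' (t.narr 1) n)
    (by decide) (by decide) (by decide) hF h2 ?_ ?_
  · exact ⟨A, hA.congr (fun _ _ _ _ => rfl) (by simp), Reduced.refl _ _ _ _⟩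
  · rintro k t hk hs hi ⟨A', hA', hred⟩
    have e0 : t.nreg 0 = V := by rw [hs.nreg 0 (by decide), hV]
    have e1 : t.nreg 1 = F := by rw [hs.nreg 1 (by decide), hF]
    have e2 : t.nreg 2 = 1 := by rw [hs.nreg 2 (by decide), h2]
    have e22 : t.nreg 22 = 0 := by rw [hs.nreg 22 (by decide), h22]
    refine Runs.seq (runs_findPivot e0 e1 e2 e22 hi hk hA') ?_
    rintro t1 ⟨r, hr, hrV, hp⟩ hs1
    refine Runs.seq (runs_clearRow (r := r) (by rw [hs1.nreg 0 (by decide), e0])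
      (by rw [hs1.nreg 1 (by decide), e1]) (by rw [hs1.nreg 2 (by decide), e2])
      (by rw [hs1.nreg 6 (by decide), hi]) hr (hrV hVpos) hk
      (hA'.congr (fun _ _ _ _ => rfl) (hs1.narr 0 (by decide)))) ?_
    intro t2 hA2 hs2
    refine Runs.evalLE (by decide) ⟨pivotStep A' r k, hA2.congr (fun _ _ _ _ => rfl) (by simp), ?_⟩
    have := hred.step hk hp
    convert this using 1
    have e6 : t2.nreg 6 = k := by
      rw [hs2.nreg 6 (by decide), hs1.nreg 6 (by decide), hi]
    funext x
    simp [e6, hs2.nreg 13 (by decide), hs2.narr 1 (by decide), hs1.narr 1 (by decide)]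

end RealRAM

namespace RealRAM

open Finset ColumnReduction

attribute [local simp] Prog.block Prog.eval Instr.apply Test.Holds Function.update_apply

open Prog

/-! ### Sampling thresholds -/

/-- The threshold for a coordinate with weights `w`, among `2 ^ m` equally likely numbers. -/
noncomputable def threshold (m : ℕ) (w : ZMod 2 → ℝ) : ℕ :=
  ⌈w 1 ^ 2 / normSq w * (2 ^ m - 1 - 1)⌉₊

/-- The inverse probability of the value `x` of a coordinate that is `1` with probability
`T / 2 ^ m`. -/
noncomputable def invProb (m T : ℕ) (x : ZMod 2) : ℝ :=
  if x = 1 then 2 ^ m / T else 2 ^ m / (2 ^ m - T)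

/-- Compute the thresholds (array `2`) and the inverse probabilities (arrays `3`, `4`). -/
def thresholdsProg : Prog :=
  Prog.forLoop 6 1 (block [.nload 13 1 6, .rload 7 1 13, .rload 8 2 13, .rmul 7 7 7, .rmul 8 8 8,
      .radd 7 7 8, .rdiv 8 8 7, .rsub 7 4 3, .rsub 7 7 3, .rmul 8 8 7, .nconst 15 0, .rconst 7 0] ;;
    loop (.rlt 7 8) (block [.radd 7 7 3, .nadd 15 15 2]) ;;
    block [.nstore 2 6 15, .rdiv 8 4 7, .rstore 4 6 8, .rsub 7 4 7, .rdiv 7 4 7, .rstore 3 6 7])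

/-- The ceiling is computed by counting up in a real and a natural register in parallel until the
target is reached. This takes at most 2^m rounds per column, which is affordable because 2^m will be
linear in F. -/
theorem runs_thresholds {s : State} {V F m : ℕ} {w : ℕ → ZMod 2 → ℝ}
    (hF : s.nreg 1 = F) (h2 : s.nreg 2 = 1) (h3 : s.rreg 3 = 1) (h4 : s.rreg 4 = 2 ^ m)
    (hpv : ∀ j < F, s.narr 1 j ≤ V)
    (hw : ∀ a ≤ V, s.rarr 1 a = w a 0 ∧ s.rarr 2 a = w a 1)
    (hT : ∀ a ≤ V, threshold m (w a) ≤ 2 ^ m) :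
    Runs thresholdsProg s (F * ((12 + ((2 ^ m * (2 + 1) + 1) + 6)) + 2) + 2) (fun s' => ∀ j < F,
      s'.narr 2 j = threshold m (w (s.narr 1 j)) ∧
      s'.rarr 3 j = invProb m (threshold m (w (s.narr 1 j))) 0 ∧
      s'.rarr 4 j = invProb m (threshold m (w (s.narr 1 j))) 1) := by
  refine Runs.forLoop F _ (fun n t => ∀ j < n,
      t.narr 2 j = threshold m (w (s.narr 1 j)) ∧
      t.rarr 3 j = invProb m (threshold m (w (s.narr 1 j))) 0 ∧
      t.rarr 4 j = invProb m (threshold m (w (s.narr 1 j))) 1)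
    (by decide) (by decide) (by decide) hF h2 (by simp) ?_
  rintro k t hk hs hi hb
  have e3 : t.rreg 3 = 1 := by rw [hs.rreg 3 (by decide), h3]
  have e4 : t.rreg 4 = 2 ^ m := by rw [hs.rreg 4 (by decide), h4]
  have e2 : t.nreg 2 = 1 := by rw [hs.nreg 2 (by decide), h2]
  have epv : t.narr 1 k = s.narr 1 k := by rw [hs.narr 1 (by decide)]
  have ew1 : t.rarr 1 (s.narr 1 k) = w (s.narr 1 k) 0 := by
    rw [hs.rarr 1 (by decide), (hw _ (hpv k hk)).1]
  have ew2 : t.rarr 2 (s.narr 1 k) = w (s.narr 1 k) 1 := by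
    rw [hs.rarr 2 (by decide), (hw _ (hpv k hk)).2]
  set W := w (s.narr 1 k) with hW
  refine Runs.seq (Q := fun s' => s'.rreg 8 = W 1 ^ 2 / normSq W * (2 ^ m - 1 - 1) ∧
    s'.nreg 15 = 0 ∧ s'.rreg 7 = 0) (Runs.evalLE (by decide) ?_) ?_
  · simp [hi, e3, e4, epv, ew1, ew2, normSq_eq, sq]
  rintro t1 ⟨h8, h15, h7⟩ hs1
  have e3' : t1.rreg 3 = 1 := by rw [hs1.rreg 3 (by decide), e3]
  have e2' : t1.nreg 2 = 1 := by rw [hs1.nreg 2 (by decide), e2]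
  refine Runs.seq (B := 2 ^ m * (2 + 1) + 1) ((Runs.loop (threshold m W) 2
    (fun k u => u.nreg 15 = k ∧ u.rreg 7 = k) ?_ ?_ ?_).mono (Q' := fun u =>
      u.nreg 15 = threshold m W ∧ u.rreg 7 = threshold m W) ?_ (fun _ h _ => h)) ?_
  · simp [h15, h7]
  · rintro n u hn hu ⟨ha, hb⟩
    refine ⟨?_, Runs.evalLE (by decide) ?_⟩
    · simp only [Test.Holds, hb, hu.rreg 8 (by decide), h8]
      exact Nat.lt_ceil.mp hn
    · simp [ha, hb, hu.rreg 3 (by decide), e3', hu.nreg 2 (by decide), e2']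
  · rintro u hu ⟨ha, hb⟩
    simp only [Test.Holds, hb, hu.rreg 8 (by decide), h8]
    exact not_lt.mpr (Nat.le_ceil _)
  · have := hT _ (hpv k hk)
    rw [← hW] at this
    nlinarith
  rintro u ⟨ha, hb'⟩ hu
  have f6 : u.nreg 6 = k := by
    rw [hu.nreg 6 (by decide), hs1.nreg 6 (by decide), hi]
  have f4 : u.rreg 4 = 2 ^ m := by rw [hu.rreg 4 (by decide), hs1.rreg 4 (by decide), e4]
  have f2 : u.narr 2 = t.narr 2 := by rw [hu.narr 2 (by decide), hs1.narr 2 (by decide)]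
  have f3 : u.rarr 3 = t.rarr 3 := by rw [hu.rarr 3 (by decide), hs1.rarr 3 (by decide)]
  have f4' : u.rarr 4 = t.rarr 4 := by rw [hu.rarr 4 (by decide), hs1.rarr 4 (by decide)]
  refine Runs.evalLE (by decide) ?_
  intro j hj
  rcases Nat.lt_succ_iff_lt_or_eq.mp hj with hj | rfl
  · simpa [f6, hj.ne, f2, f3, f4'] using hb j hj
  · simp [f6, ha, f4, hb', invProb, hW]

/-! ### Drawing a sample -/

/-- The number with binary digits `ω 0, …, ω (m - 1)`. -/
def draw (m : ℕ) (ω : ℕ → Bool) : ℕ := ∑ l ∈ range m, if ω l then 2 ^ l else 0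

/-- The `j`-th coordinate of the sample. -/
def sampleBit (m : ℕ) (T : ℕ → ℕ) (ω : ℕ → Bool) (j : ℕ) : ZMod 2 :=
  if draw m (fun l => ω (l + j * m)) < T j then 1 else 0

/-- Draw a uniform number below `r3`. -/
def drawProg : Prog :=
  block [.nconst 16 0, .nconst 17 1] ;;
  loop (.nlt 17 3) (block [.flip 18] ;; Prog.cond (.neq 18 2) (block [.nadd 16 16 17]) skip ;;
    block [.nadd 17 17 17])

theorem runs_draw {s : State} {m : ℕ} {ω : ℕ → Bool} (h2 : s.nreg 2 = 1) (h3 : s.nreg 3 = 2 ^ m)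
    (hω : s.coins = ω) :
    Runs drawProg s (2 + (m * (4 + 1) + 1)) (fun s' => s'.nreg 16 = draw m ω ∧
      s'.coins = fun n => ω (n + m)) := by
  refine Runs.seq (Q := fun s' => s'.nreg 16 = 0 ∧ s'.nreg 17 = 1 ∧ s'.coins = ω)
    (Runs.evalLE (by decide) (by simp [hω])) ?_
  rintro s1 ⟨h16, h17, hc⟩ hs1
  have e2 : s1.nreg 2 = 1 := by rw [hs1.nreg 2 (by decide), h2]
  have e3 : s1.nreg 3 = 2 ^ m := by rw [hs1.nreg 3 (by decide), h3]
  refine (Runs.loop m 4 (fun k t => t.nreg 17 = 2 ^ k ∧ t.nreg 16 = draw k ω ∧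
    t.coins = fun n => ω (n + k)) ?_ ?_ ?_).mono le_rfl ?_
  · exact ⟨by simp [h17], by simp [draw, h16], by simp [hc]⟩
  · rintro k t hk hs ⟨ha, hb, hd⟩
    refine ⟨?_, Runs.evalLE (by decide) ⟨?_, ?_, ?_⟩⟩
    · simp only [Test.Holds, ha, hs.nreg 3 (by decide), e3]
      exact Nat.pow_lt_pow_right (by norm_num) hk
    · cases hx : ω k <;>
        simp [hd, hx, hs.nreg 2 (by decide), e2, ha, pow_succ, mul_two]
    · have : draw (k + 1) ω = draw k ω + if ω k then 2 ^ k else 0 := by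
        simp [draw, sum_range_succ]
      rw [this]
      cases hx : ω k <;>
        simp [hd, hx, hs.nreg 2 (by decide), e2, ha, hb]
    · funext n
      cases hx : ω k <;>
        simp [hd, hx, hs.nreg 2 (by decide), e2, add_assoc, add_comm 1 k]
  · rintro t hs ⟨ha, hb, hd⟩
    simp only [Test.Holds, ha, hs.nreg 3 (by decide), e3]
    exact lt_irrefl _
  · rintro t ⟨ha, hb, hd⟩ -
    exact ⟨hb, hd⟩

/-- Draw a sample (array `3`) and compute its inverse probability (register `16`). -/
def sampleProg : Prog :=
  block [.rconst 16 1] ;;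
  Prog.forLoop 6 1 (drawProg ;; (block [.nload 15 2 6] ;;
    Prog.cond (.nlt 16 15) (block [.nconst 19 1, .rload 17 4 6])
      (block [.nconst 19 0, .rload 17 3 6]) ;;
    block [.nstore 3 6 19, .rmul 16 16 17]))

theorem runs_sample {s : State} {F m : ℕ} {T : ℕ → ℕ} {ω : ℕ → Bool} (hF : s.nreg 1 = F)
    (h2 : s.nreg 2 = 1) (h3 : s.nreg 3 = 2 ^ m) (hω : s.coins = ω)
    (hT : ∀ j < F, s.narr 2 j = T j ∧ s.rarr 3 j = invProb m (T j) 0 ∧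
      s.rarr 4 j = invProb m (T j) 1) :
    Runs sampleProg s (1 + (F * (((2 + (m * (4 + 1) + 1)) + 8) + 2) + 2)) (fun s' =>
      (∀ j < F, s'.narr 3 j = (sampleBit m T ω j).val) ∧
      s'.rreg 16 = ∏ j ∈ range F, invProb m (T j) (sampleBit m T ω j) ∧
      s'.coins = fun n => ω (n + F * m)) := by
  refine Runs.seq (Q := fun s' => s'.rreg 16 = 1)
    (Runs.evalLE (by decide) (by simp)) ?_
  rintro s1 h16 hs1
  have e1 : s1.nreg 1 = F := by rw [hs1.nreg 1 (by decide), hF]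
  have e2 : s1.nreg 2 = 1 := by rw [hs1.nreg 2 (by decide), h2]
  refine Runs.forLoop F _ (fun k t => (∀ j < k, t.narr 3 j = (sampleBit m T ω j).val) ∧
      t.rreg 16 = ∏ j ∈ range k, invProb m (T j) (sampleBit m T ω j) ∧
      t.coins = fun n => ω (n + k * m))
    (by decide) (by decide) (by decide) e1 e2 ?_ ?_
  · exact ⟨by simp, by simp [h16], by simp [hs1.coins (by decide), hω]⟩
  · rintro k t hk hs hi ⟨ha, hb, hc⟩
    refine Runs.seq (runs_draw (by rw [hs.nreg 2 (by decide), e2])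
      (by rw [hs.nreg 3 (by decide), hs1.nreg 3 (by decide), h3]) hc) ?_
    rintro t1 ⟨hd, hc1⟩ hs1'
    have f6 : t1.nreg 6 = k := by rw [hs1'.nreg 6 (by decide), hi]
    have fT : t1.narr 2 k = T k := by
      rw [hs1'.narr 2 (by decide), hs.narr 2 (by decide), hs1.narr 2 (by decide), (hT k hk).1]
    have f3 : t1.rarr 3 k = invProb m (T k) 0 := by
      rw [hs1'.rarr 3 (by decide), hs.rarr 3 (by decide), hs1.rarr 3 (by decide), (hT k hk).2.1]
    have f4 : t1.rarr 4 k = invProb m (T k) 1 := by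
      rw [hs1'.rarr 4 (by decide), hs.rarr 4 (by decide), hs1.rarr 4 (by decide), (hT k hk).2.2]
    have f16 : t1.rreg 16 = t.rreg 16 := hs1'.rreg 16 (by decide)
    have fn3 : t1.narr 3 = t.narr 3 := hs1'.narr 3 (by decide)
    refine Runs.evalLE (by decide) ⟨?_, ?_, ?_⟩
    · intro j hj
      rcases Nat.lt_succ_iff_lt_or_eq.mp hj with hj | rfl
      · by_cases hx : t1.nreg 16 < T k <;>
          simp [hx, f6, fT, hj.ne, fn3, ha j hj]
      · by_cases hx : t1.nreg 16 < T j
        · have hx' := hx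
          rw [hd] at hx'
          simp [hx, f6, fT, sampleBit, hx', ZMod.val_one]
        · have hx' := hx
          rw [hd] at hx'
          simp [hx, f6, fT, sampleBit, hx']
    · rw [prod_range_succ, ← hb, ← f16]
      by_cases hx : t1.nreg 16 < T k
      · have hx' := hx
        rw [hd] at hx'
        simp [hx, f6, fT, f4, sampleBit, hx']
      · have hx' := hx
        rw [hd] at hx'
        simp [hx, f6, fT, f3, sampleBit, hx']
    · funext n
      by_cases hx : t1.nreg 16 < T k <;>
        simp [hx, f6, fT, hc1, add_assoc, Nat.succ_mul, add_comm m]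

/-- Multiply register `16` by the weight of the sample. -/
def evaluateProg : Prog :=
  block [.nconst 21 0] ;;
  Prog.forLoop 7 0 (block [.nconst 20 0] ;;
    Prog.forLoop 8 1 (block [.nload 11 0 21, .nload 19 3 8] ;;
      Prog.cond (.neq 11 2) (Prog.cond (.neq 19 2) (block [.nsub 20 2 20]) skip) skip ;;
      block [.nadd 21 21 2]) ;;
    Prog.cond (.neq 20 2) (block [.rload 17 2 7]) (block [.rload 17 1 7]) ;;
    block [.rmul 16 16 17])

theorem runs_evaluate {s : State} {V F : ℕ} {A : ℕ → ℕ → ZMod 2} {y : ℕ → ZMod 2}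
    {w : ℕ → ZMod 2 → ℝ} (hV : s.nreg 0 = V) (hF : s.nreg 1 = F) (h2 : s.nreg 2 = 1)
    (hA : Holds V F A s) (hy : ∀ j < F, s.narr 3 j = (y j).val)
    (hw : ∀ a ≤ V, s.rarr 1 a = w a 0 ∧ s.rarr 2 a = w a 1) :
    Runs evaluateProg s (1 + (V * ((1 + ((F * (6 + 2) + 2) + 4)) + 2) + 2)) (fun s' =>
      s'.rreg 16 = s.rreg 16 * ∏ a ∈ range V, w a (∑ j ∈ range F, A a j * y j)) := by
  refine Runs.seq (Q := fun s' => s'.nreg 21 = 0)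
    (Runs.evalLE (by decide) (by simp)) ?_
  intro s1 h21 hs1
  have e0 : s1.nreg 0 = V := by rw [hs1.nreg 0 (by decide), hV]
  have e1 : s1.nreg 1 = F := by rw [hs1.nreg 1 (by decide), hF]
  have e2 : s1.nreg 2 = 1 := by rw [hs1.nreg 2 (by decide), h2]
  refine (Runs.forLoop V (1 + ((F * (6 + 2) + 2) + 4)) (fun k t => t.nreg 21 = k * F ∧
    t.rreg 16 = s.rreg 16 * ∏ a ∈ range k, w a (∑ j ∈ range F, A a j * y j))
    (by decide) (by decide) (by decide) e0 e2 ?_ ?_).mono le_rfl (fun _ h _ => h.2)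
  · exact ⟨by simp [h21], by simp [hs1.rreg 16 (by decide)]⟩
  rintro k t hk hs hi ⟨ha, hb⟩
  have f1 : t.nreg 1 = F := by rw [hs.nreg 1 (by decide), e1]
  have f2 : t.nreg 2 = 1 := by rw [hs.nreg 2 (by decide), e2]
  refine Runs.seq (Q := fun s' => s'.nreg 20 = 0) (Runs.evalLE (by decide) (by simp)) ?_
  intro t1 h20 ht1
  have g1 : t1.nreg 1 = F := by rw [ht1.nreg 1 (by decide), f1]
  have g2 : t1.nreg 2 = 1 := by rw [ht1.nreg 2 (by decide), f2]
  refine Runs.seq (Runs.forLoop F 6 (fun n u => u.nreg 21 = k * F + n ∧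
    u.nreg 20 = (∑ j ∈ range n, A k j * y j).val)
    (by decide) (by decide) (by decide) g1 g2 ?_ ?_) ?_
  · exact ⟨by simp [ht1.nreg 21 (by decide), ha], by simp [h20]⟩
  · rintro n u hn hu hin ⟨hc, hd⟩
    have i2 : u.nreg 2 = 1 := by rw [hu.nreg 2 (by decide), g2]
    have iA : u.narr 0 (k * F + n) = (A k n).val := by
      rw [hu.narr 0 (by decide), ht1.narr 0 (by decide), hs.narr 0 (by decide),
        hs1.narr 0 (by decide), hA k hk n hn]
    have iy : u.narr 3 n = (y n).val := by
      rw [hu.narr 3 (by decide), ht1.narr 3 (by decide), hs.narr 3 (by decide),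
        hs1.narr 3 (by decide), hy n hn]
    refine Runs.evalLE (by decide) ?_
    rcases zmod_two_cases (A k n) with hx | hx <;> rcases zmod_two_cases (y n) with hx' | hx' <;>
      simp [hc, hd, i2, iA, iy, hin, hx, hx', sum_range_succ, add_assoc, ZMod.val_one, one_sub_val]
  · rintro u ⟨hc, hd⟩ hu
    have i2 : u.nreg 2 = 1 := by rw [hu.nreg 2 (by decide), g2]
    have i7 : u.nreg 7 = k := by rw [hu.nreg 7 (by decide), ht1.nreg 7 (by decide), hi]
    have w1 : u.rarr 1 k = w k 0 := by
      rw [hu.rarr 1 (by decide), ht1.rarr 1 (by decide), hs.rarr 1 (by decide),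
        hs1.rarr 1 (by decide), (hw k hk.le).1]
    have w2 : u.rarr 2 k = w k 1 := by
      rw [hu.rarr 2 (by decide), ht1.rarr 2 (by decide), hs.rarr 2 (by decide),
        hs1.rarr 2 (by decide), (hw k hk.le).2]
    have i16 : u.rreg 16 = t.rreg 16 := by
      rw [hu.rreg 16 (by decide), ht1.rreg 16 (by decide)]
    refine Runs.evalLE (by decide) ⟨?_, ?_⟩
    · by_cases hx : u.nreg 20 = 1 <;> simp [i2, hx, hc, Nat.succ_mul]
    · rw [prod_range_succ, ← mul_assoc, ← hb, ← i16]
      rcases zmod_two_cases (∑ j ∈ range F, A k j * y j) with hx | hx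
      · simp [hd, hx, i2, i7, w1]
      · simp [hd, hx, i2, i7, w2, ZMod.val_one]

/-! ### The sampling loop -/

/-- The importance-sampling estimator. -/
noncomputable def estimator (V F m : ℕ) (w : ℕ → ZMod 2 → ℝ) (A : ℕ → ℕ → ZMod 2) (T : ℕ → ℕ)
    (y : ℕ → ZMod 2) : ℝ :=
  (∏ j ∈ range F, invProb m (T j) (y j)) * ∏ a ∈ range V, w a (∑ j ∈ range F, A a j * y j)

open Classical in
/-- Truncation at level `B`. -/
noncomputable def trunc (B x : ℝ) : ℝ := if B < x then 0 else x

/-- Average truncated estimators over independent samples. -/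
def averageProg : Prog :=
  block [.rconst 10 0, .rconst 11 0, .rconst 12 2, .rsub 13 3 2, .rmul 14 1 1, .rconst 15 16,
    .rdiv 14 14 15, .rsub 14 9 14, .rexp 14 14, .rsqrt 15 5, .rconst 17 32, .rmul 15 17 15,
    .rdiv 15 15 1] ;;
  loop (.rlt 13 12) (sampleProg ;; evaluateProg ;;
    (Prog.cond (.rlt 15 16) skip (block [.radd 11 11 16]) ;; block [.radd 10 10 3, .rmul 12 12 14])) ;;
  block [.rdiv 0 11 10]

/-- The machine has no logarithm, so the failure bound 2exp(-ε²/16)^k is itself updated in a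
register and compared with 1-p. The hypothesis `hN` says that this test stops after exactly N
samples, whatever the coins show. -/
theorem runs_average {s : State} {V F m N : ℕ} {A : ℕ → ℕ → ZMod 2} {T : ℕ → ℕ}
    {w : ℕ → ZMod 2 → ℝ} {ω : ℕ → Bool} {ε p n2 : ℝ}
    (hV : s.nreg 0 = V) (hF : s.nreg 1 = F) (h2 : s.nreg 2 = 1) (h3 : s.nreg 3 = 2 ^ m)
    (hω : s.coins = ω) (hε : s.rreg 1 = ε) (hp : s.rreg 2 = p) (h3' : s.rreg 3 = 1)
    (h5 : s.rreg 5 = n2) (h9 : s.rreg 9 = 0)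
    (hA : Holds V F A s)
    (hw : ∀ a ≤ V, s.rarr 1 a = w a 0 ∧ s.rarr 2 a = w a 1)
    (hT : ∀ j < F, s.narr 2 j = T j ∧ s.rarr 3 j = invProb m (T j) 0 ∧
      s.rarr 4 j = invProb m (T j) 1)
    (hN : ∀ k : ℕ, 1 - p < 2 * Real.exp (-(ε * ε / 16)) ^ k ↔ k < N) :
    Runs averageProg s (13 + ((N * (((1 + (F * (((2 + (m * (4 + 1) + 1)) + 8) + 2) + 2)) +
      ((1 + (V * ((1 + ((F * (6 + 2) + 2) + 4)) + 2) + 2)) + 4)) + 1) + 1) + 1)) (fun s' =>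
      s'.rreg 0 = (∑ k ∈ range N, trunc (32 * √n2 / ε) (estimator V F m w A T
        (sampleBit m T fun n => ω (n + k * (F * m))))) / N) := by
  refine Runs.seq (Q := fun s' => s'.rreg 10 = 0 ∧ s'.rreg 11 = 0 ∧ s'.rreg 12 = 2 ∧
    s'.rreg 13 = 1 - p ∧ s'.rreg 14 = Real.exp (-(ε * ε / 16)) ∧ s'.rreg 15 = 32 * √n2 / ε)
    (Runs.evalLE (by decide) (by simp [hε, hp, h3', h5, h9])) ?_
  rintro s1 ⟨e10, e11, e12, e13, e14, e15⟩ hs1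
  refine Runs.seq (Runs.loop N ((1 + (F * (((2 + (m * (4 + 1) + 1)) + 8) + 2) + 2)) +
      ((1 + (V * ((1 + ((F * (6 + 2) + 2) + 4)) + 2) + 2)) + 4)) (fun n t =>
    t.rreg 10 = n ∧ t.rreg 12 = 2 * Real.exp (-(ε * ε / 16)) ^ n ∧
    (t.coins = fun i => ω (i + n * (F * m))) ∧
    t.rreg 11 = ∑ k ∈ range n, trunc (32 * √n2 / ε) (estimator V F m w A T
        (sampleBit m T fun n => ω (n + k * (F * m))))) ?_ ?_ ?_) ?_
  · exact ⟨by simp [e10], by simp [e12], by simp [hs1.coins (by decide), hω], by simp [e11]⟩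
  · rintro k t hk hs ⟨ha, hb, hc, hd⟩
    refine ⟨?_, ?_⟩
    · simp only [Test.Holds, hb, hs.rreg 13 (by decide), e13]
      exact (hN k).mpr hk
    have f0 : t.nreg 0 = V := by rw [hs.nreg 0 (by decide), hs1.nreg 0 (by decide), hV]
    have f1 : t.nreg 1 = F := by rw [hs.nreg 1 (by decide), hs1.nreg 1 (by decide), hF]
    have f2 : t.nreg 2 = 1 := by rw [hs.nreg 2 (by decide), hs1.nreg 2 (by decide), h2]
    have f3 : t.nreg 3 = 2 ^ m := by rw [hs.nreg 3 (by decide), hs1.nreg 3 (by decide), h3]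
    have f3' : t.rreg 3 = 1 := by rw [hs.rreg 3 (by decide), hs1.rreg 3 (by decide), h3']
    have f14 := (hs.rreg 14 (by decide)).trans e14
    have f15 := (hs.rreg 15 (by decide)).trans e15
    refine Runs.seq (runs_sample (T := T) f1 f2 f3 hc (fun j hj => ?_)) ?_
    · rw [hs.narr 2 (by decide), hs1.narr 2 (by decide), hs.rarr 3 (by decide),
        hs1.rarr 3 (by decide), hs.rarr 4 (by decide), hs1.rarr 4 (by decide)]
      exact hT j hj
    rintro t1 ⟨hy, h16, hc1⟩ ht1
    refine Runs.seq (runs_evaluate (w := w) (by rw [ht1.nreg 0 (by decide), f0])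
      (by rw [ht1.nreg 1 (by decide), f1]) (by rw [ht1.nreg 2 (by decide), f2])
      (hA.congr (fun _ _ _ _ => rfl) (by
        rw [ht1.narr 0 (by decide), hs.narr 0 (by decide), hs1.narr 0 (by decide)])) hy ?_) ?_
    · rw [ht1.rarr 1 (by decide), hs.rarr 1 (by decide), hs1.rarr 1 (by decide),
        ht1.rarr 2 (by decide), hs.rarr 2 (by decide), hs1.rarr 2 (by decide)]
      exact hw
    intro t2 hX ht2
    rw [h16] at hX
    change t2.rreg 16 = estimator V F m w A T _ at hX
    have g3 : t2.rreg 3 = 1 := by rw [ht2.rreg 3 (by decide), ht1.rreg 3 (by decide), f3']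
    have g10 : t2.rreg 10 = k := by rw [ht2.rreg 10 (by decide), ht1.rreg 10 (by decide), ha]
    have g11 := (ht2.rreg 11 (by decide)).trans ((ht1.rreg 11 (by decide)).trans hd)
    have g12 := (ht2.rreg 12 (by decide)).trans ((ht1.rreg 12 (by decide)).trans hb)
    have g14 := (ht2.rreg 14 (by decide)).trans ((ht1.rreg 14 (by decide)).trans f14)
    have g15 := (ht2.rreg 15 (by decide)).trans ((ht1.rreg 15 (by decide)).trans f15)
    have gc := (ht2.coins (by decide)).trans hc1
    refine Runs.evalLE (by decide) ?_
    by_cases hx : t2.rreg 15 < t2.rreg 16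
    · have hx' := hx
      rw [g15, hX] at hx'
      refine ⟨by simp [hx, g10, g3], by simp [hx, g12, g14, pow_succ, mul_assoc], ?_, ?_⟩
      · funext i
        simp [hx, gc, Nat.succ_mul, add_assoc, add_comm (F * m)]
      · simp [hx, g11, sum_range_succ, trunc, hx']
    · have hx' := hx
      rw [g15, hX] at hx'
      refine ⟨by simp [hx, g10, g3], by simp [hx, g12, g14, pow_succ, mul_assoc], ?_, ?_⟩
      · funext i
        simp [hx, gc, Nat.succ_mul, add_assoc, add_comm (F * m)]
      · simp only [sum_range_succ]
        rw [trunc, if_neg hx', ← hX]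
        simp [hx, g11]
  · rintro t hs ⟨ha, hb, hc, hd⟩
    simp only [Test.Holds, hb, hs.rreg 13 (by decide), e13]
    rw [hN N]
    exact lt_irrefl _
  · rintro t ⟨ha, hb, hc, hd⟩ hs
    exact Runs.evalLE (by decide) (by simp [ha, hd])

end RealRAM

/-! ## Probability estimates -/

namespace RealRAM

open Finset ColumnReduction MeasureTheory

/-! ### Truncated means -/

/-- One-sided exponential tail bound for sums of independent uniform samples. -/
theorem card_tail_le {Ω : Type*} [Fintype Ω] {Y : Ω → ℝ} {B S μ τ : ℝ} (N : ℕ) (hB : 0 < B)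
    (hY : ∀ a, |Y a| ≤ B) (hμ : ∑ a, Y a = Fintype.card Ω * μ)
    (hS : ∑ a, Y a ^ 2 ≤ Fintype.card Ω * S) :
    (#{x : Fin N → Ω | N * (μ + τ) < ∑ k, Y (x k)} : ℝ) ≤
      (Fintype.card Ω : ℝ) ^ N * Real.exp (S / B ^ 2 - τ / B) ^ N := by
  have hexp : ∑ a, Real.exp ((Y a - (μ + τ)) / B) ≤
      Fintype.card Ω * Real.exp (S / B ^ 2 - τ / B) := by
    -- Uses exp x ≤ 1 + x + x² for |x| ≤ 1, which is where boundedness of Y by B is needed.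
    have h1 : ∀ a, Real.exp ((Y a - (μ + τ)) / B) ≤
        (1 + Y a / B + Y a ^ 2 / B ^ 2) * Real.exp (-((μ + τ) / B)) := by
      intro a
      rw [sub_div, sub_eq_add_neg, Real.exp_add]
      refine mul_le_mul_of_nonneg_right ?_ (Real.exp_pos _).le
      have hx : |Y a / B| ≤ 1 := by
        rw [abs_div, abs_of_pos hB, div_le_one hB]
        exact hY a
      have := (abs_le.mp (Real.abs_exp_sub_one_sub_id_le hx)).2
      rw [div_pow] at this
      linarith
    calc ∑ a, Real.exp ((Y a - (μ + τ)) / B)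
        ≤ ∑ a, (1 + Y a / B + Y a ^ 2 / B ^ 2) * Real.exp (-((μ + τ) / B)) :=
          sum_le_sum fun a _ => h1 a
      _ = (Fintype.card Ω + (∑ a, Y a) / B + (∑ a, Y a ^ 2) / B ^ 2) *
            Real.exp (-((μ + τ) / B)) := by
          rw [← sum_mul, sum_add_distrib, sum_add_distrib, sum_div, sum_div]
          simp
      _ ≤ (Fintype.card Ω * (μ / B + S / B ^ 2 + 1)) * Real.exp (-((μ + τ) / B)) := by
          refine mul_le_mul_of_nonneg_right ?_ (Real.exp_pos _).le
          have : (∑ a, Y a ^ 2) / B ^ 2 ≤ Fintype.card Ω * S / B ^ 2 := by gcongr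
          rw [hμ]
          calc _ ≤ _ := add_le_add_right this _
            _ = _ := by ring
      _ ≤ (Fintype.card Ω * Real.exp (μ / B + S / B ^ 2)) * Real.exp (-((μ + τ) / B)) := by
          gcongr
          exact Real.add_one_le_exp _
      _ = _ := by
          rw [mul_assoc, ← Real.exp_add]
          congr 2
          ring
  calc (#{x : Fin N → Ω | N * (μ + τ) < ∑ k, Y (x k)} : ℝ)
      = ∑ x : Fin N → Ω, if N * (μ + τ) < ∑ k, Y (x k) then 1 else 0 := by simp
    -- Markov's inequality for the exponential with parameter 1/B; its sum over all N-tuples then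
    -- factorises.
    _ ≤ ∑ x : Fin N → Ω, ∏ k, Real.exp ((Y (x k) - (μ + τ)) / B) := by
        refine sum_le_sum fun x _ => ?_
        rw [← Real.exp_sum]
        split_ifs with h
        · rw [Real.one_le_exp_iff, ← sum_div]
          refine div_nonneg ?_ hB.le
          simp only [sum_sub_distrib, sum_const, card_univ, Fintype.card_fin, nsmul_eq_mul]
          linarith
        · exact (Real.exp_pos _).le
    _ = (∑ a, Real.exp ((Y a - (μ + τ)) / B)) ^ N :=
        (Fintype.sum_pow (fun a => Real.exp ((Y a - (μ + τ)) / B)) N).symm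
    _ ≤ _ := by
        rw [← mul_pow]
        exact pow_le_pow_left₀ (sum_nonneg fun _ _ => (Real.exp_pos _).le) hexp N

theorem trunc_nonneg {B x : ℝ} (hx : 0 ≤ x) : 0 ≤ trunc B x := by
  unfold trunc
  split_ifs <;> simp [hx]

theorem trunc_le {B x : ℝ} (hB : 0 ≤ B) : trunc B x ≤ B := by
  unfold trunc
  split_ifs with h
  · exact hB
  · exact not_lt.mp h

theorem trunc_le_self {B x : ℝ} (hx : 0 ≤ x) : trunc B x ≤ x := by
  unfold trunc
  split_ifs <;> simp [hx]

/-- Truncation loses only values x > B, for which x ≤ x²/B. The bias is therefore at most the second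
moment divided by B. -/
theorem self_sub_trunc_le {B x : ℝ} (hB : 0 < B) (hx : 0 ≤ x) : x - x ^ 2 / B ≤ trunc B x := by
  unfold trunc
  split_ifs with h
  · rw [sub_nonpos, le_div_iff₀ hB]
    nlinarith
  · have : 0 ≤ x ^ 2 / B := by positivity
    linarith

/-- Concentration of truncated means of a nonnegative variable with bounded second moment. -/
theorem card_truncated_mean_le {Ω : Type*} [Fintype Ω] [Nonempty Ω] {X : Ω → ℝ} {B S Z τ : ℝ}
    {N : ℕ} (hN : 0 < N) (hB : 0 < B) (hX : ∀ a, 0 ≤ X a)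
    (hZ : ∑ a, X a = Fintype.card Ω * Z)
    (hS : ∑ a, X a ^ 2 ≤ Fintype.card Ω * S) :
    (#{x : Fin N → Ω | ¬ |(∑ k, trunc B (X (x k))) / N - Z| ≤ S / B + τ} : ℝ) ≤
      (Fintype.card Ω : ℝ) ^ N * (2 * Real.exp (S / B ^ 2 - τ / B) ^ N) := by
  classical
  have hK : (0 : ℝ) < Fintype.card Ω := by exact_mod_cast Fintype.card_pos
  have hN' : (0 : ℝ) < N := by exact_mod_cast hN
  let Y : Ω → ℝ := fun a => trunc B (X a)
  obtain ⟨μ, hμ⟩ : ∃ μ, ∑ a, Y a = Fintype.card Ω * μ :=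
    ⟨(∑ a, Y a) / Fintype.card Ω, by field_simp⟩
  have hYS : ∑ a, Y a ^ 2 ≤ Fintype.card Ω * S :=
    (sum_le_sum fun a _ => pow_le_pow_left₀ (trunc_nonneg (hX a)) (trunc_le_self (hX a)) 2).trans hS
  have hYB : ∀ a, |Y a| ≤ B := fun a => by
    rw [abs_of_nonneg (trunc_nonneg (hX a))]
    exact trunc_le hB.le
  have hμZ : μ ≤ Z := by
    have : ∑ a, Y a ≤ ∑ a, X a := sum_le_sum fun a _ => trunc_le_self (hX a)
    rw [hμ, hZ] at this
    exact le_of_mul_le_mul_left this hK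
  have hZμ : Z - S / B ≤ μ := by
    have h1 : ∑ a, (X a - X a ^ 2 / B) ≤ ∑ a, Y a :=
      sum_le_sum fun a _ => self_sub_trunc_le hB (hX a)
    rw [sum_sub_distrib, ← sum_div, hμ, hZ] at h1
    have h2 : (∑ a, X a ^ 2) / B ≤ Fintype.card Ω * S / B := by gcongr
    refine le_of_mul_le_mul_left ?_ hK
    calc (Fintype.card Ω : ℝ) * (Z - S / B) = Fintype.card Ω * Z - Fintype.card Ω * S / B := by ring
      _ ≤ _ := by linarith
  have hS0 : 0 ≤ S / B := by linarith
  have up := card_tail_le (τ := τ) N hB hYB hμ hYS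
  -- The lower tail is the upper tail of -Y.
  have lo := card_tail_le (τ := τ) (Y := fun a => - Y a) (μ := -μ) (S := S) N hB (by simpa using hYB)
    (by simp [hμ]) (by simpa using hYS)
  have hsub : ({x : Fin N → Ω | ¬ |(∑ k, trunc B (X (x k))) / N - Z| ≤ S / B + τ} : Finset _) ⊆
      ({x : Fin N → Ω | N * (μ + τ) < ∑ k, Y (x k)} : Finset _) ∪
        ({x : Fin N → Ω | N * (-μ + τ) < ∑ k, - Y (x k)} : Finset _) := by
    intro x
    simp only [mem_filter, mem_univ, true_and, mem_union]
    contrapose!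
    rintro ⟨h1, h2⟩
    rw [sum_neg_distrib] at h2
    rw [abs_le]
    constructor
    · have : μ - τ ≤ (∑ k, Y (x k)) / N := by
        rw [le_div_iff₀ hN']
        linarith
      change _ ≤ (∑ k, Y (x k)) / N - Z
      linarith
    · have : (∑ k, Y (x k)) / N ≤ μ + τ := by
        rw [div_le_iff₀ hN']
        linarith
      change (∑ k, Y (x k)) / N - Z ≤ _
      linarith
  have hcard := (card_le_card hsub).trans (card_union_le _ _)
  have hcard' : (#{x : Fin N → Ω | ¬ |(∑ k, trunc B (X (x k))) / N - Z| ≤ S / B + τ} : ℝ) ≤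
      #{x : Fin N → Ω | N * (μ + τ) < ∑ k, Y (x k)} +
        #{x : Fin N → Ω | N * (-μ + τ) < ∑ k, - Y (x k)} := by exact_mod_cast hcard
  linarith

/-! ### Coins -/

theorem coinMeasure_fiber {ι : Type*} [Fintype ι] (e : ι ↪ ℕ) (x : ι → Bool) :
    coinMeasure {ω | ∀ i, ω (e i) = x i} = ((2 : ENNReal) ^ Fintype.card ι)⁻¹ := by
  classical
  have hset : {ω : ℕ → Bool | ∀ i, ω (e i) = x i} =
      Set.pi (univ.map e : Finset ℕ) (fun n => {b | ∀ i, e i = n → b = x i}) := by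
    ext ω
    simp
  rw [hset, coinMeasure, Measure.infinitePi_pi _ (fun _ _ => MeasurableSet.of_discrete), prod_map]
  have h1 : ∀ i, {b | ∀ i', e i' = e i → b = x i'} = {x i} := by
    intro i
    ext b
    simp only [e.injective.eq_iff, forall_eq, Set.mem_ofPred_eq, Set.mem_singleton_iff]
  simp only [h1]
  have h2 : ∀ b : Bool, (PMF.uniformOfFintype Bool).toMeasure {b} = 2⁻¹ := by
    intro b
    rw [PMF.toMeasure_apply_singleton _ _ (MeasurableSet.singleton b)]
    simp
  simp only [h2, prod_const, card_univ, ENNReal.inv_pow]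

/-- The position of coin `l` of coordinate `j` of sample `k`. -/
def coinIndex (N F m : ℕ) : Fin N × Fin F × Fin m ↪ ℕ where
  toFun i := i.2.2 + i.2.1 * m + i.1 * (F * m)
  inj' := by
    intro i i' h
    -- Injectivity is uniqueness of mixed-radix digits with bases m and F·m.
    have h' : finProdFinEquiv (i.1, finProdFinEquiv i.2) =
        finProdFinEquiv (i'.1, finProdFinEquiv i'.2) := by
      apply Fin.ext
      simp only [finProdFinEquiv_apply_val]
      rw [mul_comm m, mul_comm m, mul_comm (F * m), mul_comm (F * m)]
      exact h
    have := finProdFinEquiv.injective h'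
    simp only [Prod.mk.injEq, EmbeddingLike.apply_eq_iff_eq] at this
    exact Prod.ext this.1 this.2

open Classical in
-- Such an event is a disjoint union of cylinders of equal measure, one for each admissible pattern
-- of the N·F·m coins. Afterwards all probability is counting.
theorem coinMeasure_event (N F m : ℕ) (S : (Fin N → Fin F → Fin m → Bool) → Prop) :
    coinMeasure {ω | S fun k j l => ω (l + j * m + k * (F * m))} =
      (#{x | S x} : ENNReal) / Fintype.card (Fin N → Fin F → Fin m → Bool) := by
  let π : (ℕ → Bool) → Fin N → Fin F → Fin m → Bool := fun ω k j l => ω (l + j * m + k * (F * m))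
  have hset : {ω | S (π ω)} = ⋃ x ∈ (univ.filter S), {ω | π ω = x} := by
    ext ω
    simp
  have hfib : ∀ x, {ω | π ω = x} =
      {ω | ∀ i, ω (coinIndex N F m i) = (fun i : Fin N × Fin F × Fin m => x i.1 i.2.1 i.2.2) i} := by
    intro x
    ext ω
    simp only [Set.mem_ofPred_eq, funext_iff, Prod.forall]
    rfl
  have hmeas : ∀ x, MeasurableSet {ω | π ω = x} := by
    intro x
    refine measurableSet_eq_fun ?_ measurable_const
    exact measurable_pi_lambda _ fun k => measurable_pi_lambda _ fun j =>
      measurable_pi_lambda _ fun l => measurable_pi_apply _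
  change coinMeasure {ω | S (π ω)} = _
  rw [hset, measure_biUnion_finset _ (fun x _ => hmeas x)]
  · simp only [hfib, coinMeasure_fiber]
    simp only [sum_const, nsmul_eq_mul, div_eq_mul_inv]
    congr 2
    simp [← pow_mul, mul_comm]
  · intro x _ x' _ hne
    rw [Function.onFun, Set.disjoint_left]
    intro ω h h'
    exact hne (h.symm.trans h')

open Classical in
theorem le_coinMeasure_event {N F m : ℕ} {S : (Fin N → Fin F → Fin m → Bool) → Prop} {p : ℝ}
    (h : (#{x | ¬ S x} : ℝ) ≤
      Fintype.card (Fin N → Fin F → Fin m → Bool) * (1 - p)) :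
    ENNReal.ofReal p ≤ coinMeasure {ω | S fun k j l => ω (l + j * m + k * (F * m))} := by
  rw [coinMeasure_event]
  have hK : (0 : ℝ) < Fintype.card (Fin N → Fin F → Fin m → Bool) := by
    exact_mod_cast Fintype.card_pos
  have hsum : (#{x | S x} : ℝ) + #{x | ¬ S x} = Fintype.card (Fin N → Fin F → Fin m → Bool) := by
    exact_mod_cast card_filter_add_card_filter_not (s := univ) S
  have h' : p ≤ (#{x | S x} : ℝ) / Fintype.card (Fin N → Fin F → Fin m → Bool) := by
    rw [le_div_iff₀ hK]
    linarith
  refine (ENNReal.ofReal_le_ofReal h').trans (le_of_eq ?_)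
  rw [ENNReal.ofReal_div_of_pos hK, ENNReal.ofReal_natCast, ENNReal.ofReal_natCast]

/-! ### Uniform numbers from coins -/

theorem card_draw_lt {m T : ℕ} (hT : T ≤ 2 ^ m) :
    #{u : Fin m → Bool | (∑ l : Fin m, if u l then 2 ^ (l : ℕ) else 0) < T} = T := by
  classical
  let e : (Fin m → Bool) ≃ Fin (2 ^ m) :=
    (Equiv.arrowCongr (Equiv.refl _) finTwoEquiv.symm).trans finFunctionFinEquiv
  have he : ∀ u, (e u : ℕ) = ∑ l : Fin m, if u l then 2 ^ (l : ℕ) else 0 := by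
    intro u
    simp only [e, Equiv.trans_apply, finFunctionFinEquiv_apply]
    refine sum_congr rfl fun l _ => ?_
    cases h : u l <;> simp [h, finTwoEquiv]
  simp only [← he]
  rw [card_equiv (t := ({i | (i : ℕ) < T} : Finset (Fin (2 ^ m)))) e (by simp)]
  rw [Fin.card_filter_val_lt, min_eq_right hT]

/-- The number of coin patterns for which a coordinate with threshold `T` has the value `x`. -/
def patternCount (m T : ℕ) (x : ZMod 2) : ℕ := if x = 1 then T else 2 ^ m - T

/-- The value of a coordinate as a function of its coins. -/
def bitOf (m T : ℕ) (u : Fin m → Bool) : ZMod 2 :=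
  if (∑ l : Fin m, if u l then 2 ^ (l : ℕ) else 0) < T then 1 else 0

theorem card_bitOf {m T : ℕ} (hT : T ≤ 2 ^ m) (x : ZMod 2) :
    #{u : Fin m → Bool | bitOf m T u = x} = patternCount m T x := by
  have h1 : #{u : Fin m → Bool | bitOf m T u = 1} = T := by
    refine Eq.trans (congrArg card ?_) (card_draw_lt hT)
    ext u
    simp [bitOf]
  rcases zmod_two_cases x with rfl | rfl
  · have h2 := card_filter_add_card_filter_not (s := (univ : Finset (Fin m → Bool)))
      (fun u => bitOf m T u = 1)
    rw [h1, card_univ, Fintype.card_fun, Fintype.card_bool, Fintype.card_fin] at h2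
    have h3 : ({u | ¬ bitOf m T u = 1} : Finset (Fin m → Bool)) = ({u | bitOf m T u = 0} : Finset _) := by
      ext u
      rcases zmod_two_cases (bitOf m T u) with h | h <;> simp [h]
    rw [h3] at h2
    simp only [patternCount, zero_ne_one, if_false]
    omega
  · rw [h1]
    simp [patternCount]

/-- Group the coin patterns by the vector they produce. Different coordinates use disjoint coins, so
each fibre is a product of coordinate fibres. -/
theorem sum_bitOf {F m : ℕ} {T : ℕ → ℕ} (hT : ∀ j < F, T j ≤ 2 ^ m) (H : (Fin F → ZMod 2) → ℝ) :
    ∑ u : Fin F → Fin m → Bool, H (fun j => bitOf m (T j) (u j)) =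
      ∑ y, (∏ j : Fin F, (patternCount m (T j) (y j) : ℝ)) * H y := by
  classical
  rw [← sum_fiberwise univ (fun (u : Fin F → Fin m → Bool) (j : Fin F) => bitOf m (T j) (u j))]
  refine sum_congr rfl fun y _ => ?_
  rw [sum_congr rfl (g := fun _ => H y)]
  · rw [sum_const, nsmul_eq_mul]
    congr 1
    have : ({u | (fun j : Fin F => bitOf m (T j) (u j)) = y} : Finset (Fin F → Fin m → Bool)) =
        Fintype.piFinset fun j : Fin F => ({v | bitOf m (T j) v = y j} : Finset (Fin m → Bool)) := by
      ext u
      simp [funext_iff]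
    rw [this, Fintype.card_piFinset]
    push_cast
    refine prod_congr rfl fun j _ => ?_
    rw [card_bitOf (hT j j.2)]
  · intro u hu
    rw [(mem_filter.mp hu).2]

theorem patternCount_mul_invProb {m T : ℕ} (h0 : 0 < T) (h1 : T < 2 ^ m) (x : ZMod 2) :
    (patternCount m T x : ℝ) * invProb m T x = 2 ^ m := by
  have h0' : (0 : ℝ) < T := by exact_mod_cast h0
  have h1' : (T : ℝ) < 2 ^ m := by exact_mod_cast h1
  unfold patternCount invProb
  split_ifs
  · field_simp
  · rw [Nat.cast_sub h1.le]
    push_cast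
    exact mul_div_cancel₀ _ (by linarith)

/-! ### Thresholds -/

section Thresholds

variable {m : ℕ} {w : ZMod 2 → ℝ}

/-- Scaling by 2^m - 2 instead of 2^m leaves room for rounding up: both outcomes keep at least their
ideal share of 2^m - 2 patterns. Hence neither has probability 0, and an inverse probability exceeds
its ideal value by a factor of at most 2^m/(2^m - 2). -/
theorem threshold_bounds (hm : 4 ≤ 2 ^ m) (hw : ∀ x, 0 < w x) :
    w 1 ^ 2 / normSq w * (2 ^ m - 2) ≤ threshold m w ∧
      w 0 ^ 2 / normSq w * (2 ^ m - 2) ≤ 2 ^ m - threshold m w := by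
  have h4 : (4 : ℝ) ≤ 2 ^ m := by exact_mod_cast hm
  have hn : 0 < normSq w := by
    rw [normSq_eq]
    have := hw 0
    have := hw 1
    positivity
  have hsum : w 0 ^ 2 / normSq w = 1 - w 1 ^ 2 / normSq w := by
    rw [eq_sub_iff_add_eq, ← add_div, ← normSq_eq, div_self hn.ne']
  have e : ((2 : ℝ) ^ m - 1 - 1) = 2 ^ m - 2 := by ring
  have hnn : 0 ≤ w 1 ^ 2 / normSq w * ((2 : ℝ) ^ m - 1 - 1) :=
    mul_nonneg (by positivity) (by linarith)
  constructor
  · rw [← e]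
    exact Nat.le_ceil _
  · have := Nat.ceil_lt_add_one hnn
    rw [hsum]
    unfold threshold
    linarith

theorem threshold_pos (hm : 4 ≤ 2 ^ m) (hw : ∀ x, 0 < w x) : 0 < threshold m w := by
  have h4 : (4 : ℝ) ≤ 2 ^ m := by exact_mod_cast hm
  have h1 := hw 1
  have h0 := hw 0
  have hn : 0 < normSq w := by rw [normSq_eq]; positivity
  have : 0 < w 1 ^ 2 / normSq w * ((2 : ℝ) ^ m - 2) := mul_pos (by positivity) (by linarith)
  exact_mod_cast this.trans_le (threshold_bounds hm hw).1

theorem threshold_lt (hm : 4 ≤ 2 ^ m) (hw : ∀ x, 0 < w x) : threshold m w < 2 ^ m := by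
  have h4 : (4 : ℝ) ≤ 2 ^ m := by exact_mod_cast hm
  have h1 := hw 1
  have h0 := hw 0
  have hn : 0 < normSq w := by rw [normSq_eq]; positivity
  have : 0 < w 0 ^ 2 / normSq w * ((2 : ℝ) ^ m - 2) := mul_pos (by positivity) (by linarith)
  have h := this.trans_le (threshold_bounds hm hw).2
  have : (threshold m w : ℝ) < 2 ^ m := by linarith
  exact_mod_cast this

theorem invProb_threshold_nonneg (hm : 4 ≤ 2 ^ m) (hw : ∀ x, 0 < w x) (x : ZMod 2) :
    0 ≤ invProb m (threshold m w) x := by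
  have : (threshold m w : ℝ) < 2 ^ m := by exact_mod_cast threshold_lt hm hw
  unfold invProb
  split_ifs
  · positivity
  · exact div_nonneg (by positivity) (by linarith)

theorem invProb_threshold_le (hm : 4 ≤ 2 ^ m) (hw : ∀ x, 0 < w x) (x : ZMod 2) :
    invProb m (threshold m w) x ≤ 2 ^ m / (2 ^ m - 2) * (normSq w / w x ^ 2) := by
  have h4 : (4 : ℝ) ≤ 2 ^ m := by exact_mod_cast hm
  have h2 : (0 : ℝ) < 2 ^ m - 2 := by linarith
  have h1 := hw 1
  have h0 := hw 0
  have hn : 0 < normSq w := by rw [normSq_eq]; positivity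
  have hb := threshold_bounds hm hw
  have key : ∀ c t : ℝ, 0 < c → c ^ 2 / normSq w * (2 ^ m - 2) ≤ t →
      2 ^ m / t ≤ 2 ^ m / (2 ^ m - 2) * (normSq w / c ^ 2) := by
    intro c t hc ht
    have hpos : 0 < c ^ 2 / normSq w * ((2 : ℝ) ^ m - 2) := by positivity
    calc (2 : ℝ) ^ m / t ≤ 2 ^ m / (c ^ 2 / normSq w * (2 ^ m - 2)) :=
          div_le_div_of_nonneg_left (by positivity) hpos ht
      _ = _ := by field_simp
  unfold invProb
  rcases zmod_two_cases x with rfl | rfl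
  · simpa using key _ _ h0 hb.2
  · simpa using key _ _ h1 hb.1

end Thresholds

/-- Bernoulli's inequality: (1 - 2/2^m)^F ≥ 1 - 2F/2^m ≥ 1/2. -/
theorem rounding_pow_le {F m : ℕ} (hF : 0 < F) (hm : 4 * F ≤ 2 ^ m) :
    ((2 : ℝ) ^ m / (2 ^ m - 2)) ^ F ≤ 2 := by
  have hm' : 4 * (F : ℝ) ≤ 2 ^ m := by exact_mod_cast hm
  have hF' : (1 : ℝ) ≤ F := by exact_mod_cast hF
  have h2 : (0 : ℝ) < 2 ^ m - 2 := by linarith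
  have hM : (0 : ℝ) < 2 ^ m := by positivity
  have hb := one_add_mul_le_pow (R := ℝ) (a := -(2 / 2 ^ m)) (by
    have : (2 : ℝ) / 2 ^ m ≤ 1 := by rw [div_le_one hM]; linarith
    linarith) F
  have hhalf : (1 / 2 : ℝ) ≤ (1 + -(2 / 2 ^ m)) ^ F := by
    refine le_trans ?_ hb
    have : (F : ℝ) * (2 / 2 ^ m) ≤ 1 / 2 := by
      rw [mul_div_assoc', div_le_iff₀ hM]
      linarith
    linarith
  have e : (2 : ℝ) ^ m / (2 ^ m - 2) = (1 + -(2 / 2 ^ m))⁻¹ := by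
    rw [← sub_eq_add_neg, one_sub_div hM.ne', inv_div]
  rw [e, inv_pow]
  calc _ ≤ (1 / 2 : ℝ)⁻¹ := inv_anti₀ (by norm_num) hhalf
    _ = 2 := by norm_num

/-! ### Accuracy of the average -/

theorem le_coinMeasure_average {V F m N : ℕ} {A A' : ℕ → ℕ → ZMod 2} {pv : ℕ → ℕ}
    {w : ℕ → ZMod 2 → ℝ} {ε p : ℝ} (h : Reduced V F A A' pv F) (hA : Orth V F A)
    (hker : #{y : Fin F → ZMod 2 | act V F A y = 0} ≤ 2 ^ 2) (hw : ∀ a x, 0 < w a x)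
    (hwV : ∀ x, w V x = 1) (hF : 0 < F) (hm : 4 * F ≤ 2 ^ m) (hε : 0 < ε) (hN : 0 < N)
    (hNp : 2 * Real.exp (-(ε * ε / 16)) ^ N ≤ 1 - p) :
    ENNReal.ofReal p ≤ coinMeasure {ω |
      |(∑ k ∈ range N, trunc (32 * √(∏ a ∈ range V, normSq (w a)) / ε)
          (estimator V F m w A' (fun j => threshold m (w (pv j)))
            (sampleBit m (fun j => threshold m (w (pv j))) fun n => ω (n + k * (F * m))))) / N -
        ∑ y, ∏ a : Fin V, w a (act V F A y a)| ≤ 4 * ε * √(∏ a ∈ range V, normSq (w a))} := by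
  have hm4 : 4 ≤ 2 ^ m := le_trans (by omega) hm
  set T : ℕ → ℕ := fun j => threshold m (w (pv j)) with hT
  set n2 : ℝ := ∏ a ∈ range V, normSq (w a) with hn2
  have hn2pos : 0 < n2 := prod_pos fun a _ => by
    rw [normSq_eq]
    have := hw a 0
    have := hw a 1
    positivity
  set n := √n2 with hn
  have hnpos : 0 < n := Real.sqrt_pos.mpr hn2pos
  have hnsq : n ^ 2 = n2 := Real.sq_sqrt hn2pos.le
  have hTpos : ∀ j, 0 < T j := fun j => threshold_pos hm4 (hw _)
  have hTlt : ∀ j, T j < 2 ^ m := fun j => threshold_lt hm4 (hw _)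
  let X : (Fin F → ZMod 2) → ℝ := fun y =>
    (∏ j : Fin F, invProb m (T j) (y j)) * ∏ a : Fin V, w a (act V F A' y a)
  let Ω := Fin F → Fin m → Bool
  let XΩ : Ω → ℝ := fun u => X fun j => bitOf m (T j) (u j)
  have hcardΩ : (Fintype.card Ω : ℝ) = (2 ^ m) ^ F := by simp [Ω]
  have hest : ∀ (ω : ℕ → Bool) (k : ℕ), estimator V F m w A' T
      (sampleBit m T fun n => ω (n + k * (F * m))) =
        XΩ fun j l => ω (l + j * m + k * (F * m)) := by
    intro ω k
    have hbit : ∀ j : ℕ, sampleBit m T (fun n => ω (n + k * (F * m))) j =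
        bitOf m (T j) (fun l : Fin m => ω (l + j * m + k * (F * m))) := by
      intro j
      simp only [sampleBit, draw, bitOf, sum_range]
    simp only [estimator, hbit, XΩ, X, prod_range, sum_range, act]
  have hXnn : ∀ y, 0 ≤ X y := fun y => mul_nonneg
    (prod_nonneg fun j _ => invProb_threshold_nonneg hm4 (hw _) _)
    (prod_nonneg fun a _ => (hw _ _).le)
  have hcancel : ∀ y : Fin F → ZMod 2, (∏ j : Fin F, (patternCount m (T j) (y j) : ℝ)) *
      ∏ j : Fin F, invProb m (T j) (y j) = (2 ^ m) ^ F := by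
    intro y
    rw [← prod_mul_distrib, prod_congr rfl fun (j : Fin F) _ =>
      patternCount_mul_invProb (hTpos j) (hTlt j) (y j)]
    simp
  have hmean : ∑ u, XΩ u = Fintype.card Ω * ∑ y, ∏ a : Fin V, w a (act V F A y a) := by
    rw [sum_bitOf (fun j _ => (hTlt j).le) X, hcardΩ,
      h.sum_eq (fun c => ∏ a : Fin V, w a (c a)), mul_sum]
    refine sum_congr rfl fun y _ => ?_
    rw [← hcancel y, mul_assoc]
  have hsecond : ∑ u, XΩ u ^ 2 ≤ Fintype.card Ω * (32 * n2) := by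
    have hsm := h.second_moment_le hA hker hw hwV (G := fun j => invProb m (T j))
      (fun j _ x => invProb_threshold_nonneg hm4 (hw _) x) (rounding_pow_le hF hm)
      (fun j _ x => invProb_threshold_le hm4 (hw _) x)
    rw [← prod_range (fun a => normSq (w a)), ← hn2] at hsm
    rw [sum_bitOf (fun j _ => (hTlt j).le) (fun y => X y ^ 2), hcardΩ]
    refine le_trans (le_of_eq ?_) (mul_le_mul_of_nonneg_left hsm (by positivity))
    rw [mul_sum]
    refine sum_congr rfl fun y _ => ?_
    rw [← hcancel y]
    simp only [X]
    ring
  have hB : 0 < 32 * n / ε := by positivity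
  -- With S = 32n² and B = 32n/ε the bias S/B is εn, which leaves τ = 3εn of the total 4εn. The
  -- exponent S/B² - τ/B is then ε²/32 - 3ε²/32 = -ε²/16.
  have hconc := card_truncated_mean_le (τ := 3 * ε * n) hN hB (fun u => hXnn _) hmean hsecond
  have e1 : 32 * n2 / (32 * n / ε) + 3 * ε * n = 4 * ε * n := by
    rw [← hnsq]
    field_simp
    ring
  have e2 : 32 * n2 / (32 * n / ε) ^ 2 - 3 * ε * n / (32 * n / ε) = -(ε * ε / 16) := by
    rw [← hnsq]
    field_simp
    ring
  rw [e1, e2] at hconc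
  have hfinal := le_coinMeasure_event (N := N) (F := F) (m := m) (p := p)
    (S := fun x => |(∑ k, trunc (32 * n / ε) (XΩ (x k))) / N -
      ∑ y, ∏ a : Fin V, w a (act V F A y a)| ≤ 4 * ε * n) ?_
  · refine hfinal.trans (le_of_eq ?_)
    congr 1
    ext ω
    simp only [Set.mem_ofPred_eq, hest, sum_range]
  · have e3 : (Fintype.card (Fin N → Fin F → Fin m → Bool) : ℝ) = (Fintype.card Ω : ℝ) ^ N := by
      simp [Ω]
    rw [e3]
    convert hconc.trans (mul_le_mul_of_nonneg_left hNp (by positivity))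

end RealRAM

/-! ## Combinatorics of 2-colexes -/

namespace SurfaceMap

open Finset ColumnReduction

variable {D : Type} {M : SurfaceMap D}

theorem faceOf_rev_rot (d : D) : M.faceOf (M.rev (M.rot d)) = M.faceOf d :=
  Quotient.sound (s := Equiv.Perm.SameCycle.setoid (M.rot⁻¹ * M.rev)) ⟨1, by simp [M.rev_rev]⟩

theorem vertexOf_rot (d : D) : M.vertexOf (M.rot d) = M.vertexOf d :=
  Quotient.sound (s := Equiv.Perm.SameCycle.setoid M.rot) ⟨-1, by simp⟩

theorem vertexOf_eq_iff (d d' : D) : M.vertexOf d = M.vertexOf d' ↔ M.rot.SameCycle d d' :=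
  Quotient.eq (r := Equiv.Perm.SameCycle.setoid M.rot)

theorem IsTwoColex.rot_rot_rot [Finite D] (hM : M.IsTwoColex) (d : D) :
    M.rot (M.rot (M.rot d)) = d := by
  classical
  have := Fintype.ofFinite D
  have hdeg := hM.degree (M.vertexOf d)
  have hset : {d' | M.vertexOf d' = M.vertexOf d} = {d' | M.rot.SameCycle d d'} := by
    ext d'
    simp only [Set.mem_ofPred_eq, vertexOf_eq_iff]
    exact Equiv.Perm.sameCycle_comm
  rw [hset] at hdeg
  -- A fixed dart would contradict the degree, but it satisfies the claim anyway; setting it aside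
  -- makes `cycleOf` a genuine cycle, of order 3.
  by_cases hd : M.rot d = d
  · rw [hd, hd, hd]
  have hsup : {d' | M.rot.SameCycle d d'} = ((M.rot.cycleOf d).support : Set D) := by
    ext d'
    simp only [Set.mem_ofPred_eq, mem_coe]
    exact (Equiv.Perm.mem_support_cycleOf_iff' hd).symm
  rw [hsup, Set.ncard_coe_finset, ← (Equiv.Perm.isCycle_cycleOf M.rot hd).orderOf] at hdeg
  have h3 := pow_orderOf_eq_one (M.rot.cycleOf d)
  rw [hdeg] at h3
  have h4 := Equiv.Perm.cycleOf_pow_apply_self M.rot d 3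
  rw [h3] at h4
  simpa [pow_succ] using h4.symm

theorem colour_rot_ne {c : M.Face → Fin 3}
    (hc : ∀ d : D, c (M.faceOf d) ≠ c (M.faceOf (M.rev d))) (d : D) : c (M.faceOf (M.rot d)) ≠ c (M.faceOf d) := by
  have := hc (M.rot d)
  rwa [faceOf_rev_rot] at this

/-! ### The three faces at a vertex, parity of intersections, and propagation along edges -/

section Faces

variable [Finite D]

theorem IsTwoColex.faceOf_ne (hM : M.IsTwoColex) (d : D) : M.faceOf d ≠ M.faceOf (M.rot d) ∧
    M.faceOf d ≠ M.faceOf (M.rot (M.rot d)) ∧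
    M.faceOf (M.rot d) ≠ M.faceOf (M.rot (M.rot d)) := by
  obtain ⟨c, hc⟩ := hM.colorable
  refine ⟨fun h => colour_rot_ne hc d (congrArg c h.symm), fun h => ?_,
    fun h => colour_rot_ne hc (M.rot d) (congrArg c h.symm)⟩
  have := colour_rot_ne hc (M.rot (M.rot d))
  rw [hM.rot_rot_rot] at this
  exact this (congrArg c h)

theorem IsTwoColex.vertexOf_eq_iff (hM : M.IsTwoColex) (d d' : D) : M.vertexOf d' = M.vertexOf d ↔
    d' = d ∨ d' = M.rot d ∨ d' = M.rot (M.rot d) := by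
  have hne := hM.faceOf_ne d
  have hsub : ({d, M.rot d, M.rot (M.rot d)} : Set D) ⊆ {d' | M.vertexOf d' = M.vertexOf d} := by
    rintro x (rfl | rfl | rfl) <;> simp [vertexOf_rot]
  have hcard : ({d, M.rot d, M.rot (M.rot d)} : Set D).ncard = 3 :=
    Set.ncard_eq_three.mpr ⟨_, _, _, fun h => hne.1 (congrArg _ h), fun h => hne.2.1 (congrArg _ h),
      fun h => hne.2.2 (congrArg _ h), rfl⟩
  have heq := Set.eq_of_subset_of_ncard_le hsub (by rw [hcard, hM.degree]) (Set.toFinite _)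
  have : d' ∈ ({d, M.rot d, M.rot (M.rot d)} : Set D) ↔ M.vertexOf d' = M.vertexOf d := by
    rw [heq]; rfl
  rw [← this]
  simp

theorem IsTwoColex.incident_iff (hM : M.IsTwoColex) (d : D) (f : M.Face) : M.Incident (M.vertexOf d) f ↔
    f = M.faceOf d ∨ f = M.faceOf (M.rot d) ∨ f = M.faceOf (M.rot (M.rot d)) := by
  constructor
  · rintro ⟨d', hd', rfl⟩
    rcases (hM.vertexOf_eq_iff d d').mp hd' with rfl | rfl | rfl <;> simp
  · rintro (rfl | rfl | rfl)
    · exact ⟨_, rfl, rfl⟩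
    · exact ⟨_, vertexOf_rot d, rfl⟩
    · exact ⟨_, (vertexOf_rot _).trans (vertexOf_rot d), rfl⟩

open Classical in
theorem IsTwoColex.sum_incident (hM : M.IsTwoColex) {R : Type*} [AddCommMonoid R] (d : D) (g : M.Face → R) :
    ∑ f with M.Incident (M.vertexOf d) f, g f =
      g (M.faceOf d) + (g (M.faceOf (M.rot d)) + g (M.faceOf (M.rot (M.rot d)))) := by
  have hne := hM.faceOf_ne d
  have : ({f | M.Incident (M.vertexOf d) f} : Finset M.Face) =
      {M.faceOf d, M.faceOf (M.rot d), M.faceOf (M.rot (M.rot d))} := by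
    ext f
    simp [hM.incident_iff d f]
  rw [this, sum_insert (by simp [hne.1, hne.2.1]), sum_insert (by simp [hne.2.2]), sum_singleton]

/-- Every vertex is the source of three darts, an odd number. -/
theorem IsTwoColex.sum_vertexOf (hM : M.IsTwoColex) [Fintype D] (h : M.Vertex → ZMod 2) :
    ∑ d, h (M.vertexOf d) = ∑ a, h a := by
  classical
  rw [← sum_fiberwise univ M.vertexOf]
  refine sum_congr rfl fun a _ => ?_
  rw [sum_congr rfl (g := fun _ => h a) (fun d hd => by rw [(mem_filter.mp hd).2]), sum_const]
  have : #{d | M.vertexOf d = a} = 3 := by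
    rw [← hM.degree a, ← Set.ncard_coe_finset]
    simp
  rw [this, nsmul_eq_mul]
  have h3 : ((3 : ℕ) : ZMod 2) = 1 := by decide
  rw [h3, one_mul]

/-- The next and the previous corner at a vertex are each reached by crossing an edge. Both sums
therefore reindex to the sum of u(left) v(right) over all darts, and they cancel in characteristic
2. -/
theorem IsTwoColex.sum_cross (hM : M.IsTwoColex) [Fintype D] (u v : M.Face → ZMod 2) :
    ∑ d, u (M.faceOf d) * v (M.faceOf (M.rot d)) +
      ∑ d, u (M.faceOf d) * v (M.faceOf (M.rot (M.rot d))) = 0 := by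
  have h1 : ∑ d, u (M.faceOf d) * v (M.faceOf (M.rot d)) =
      ∑ e, u (M.faceOf e) * v (M.faceOf (M.rev e)) := by
    rw [← Equiv.sum_comp M.rev (fun e => u (M.faceOf e) * v (M.faceOf (M.rev e))),
      ← Equiv.sum_comp M.rot (fun e => u (M.faceOf (M.rev e)) * v (M.faceOf (M.rev (M.rev e))))]
    simp only [M.rev_rev, faceOf_rev_rot]
  have h2 : ∑ d, u (M.faceOf d) * v (M.faceOf (M.rot (M.rot d))) =
      ∑ e, u (M.faceOf e) * v (M.faceOf (M.rev e)) := by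
    rw [← Equiv.sum_comp M.rot (fun d => u (M.faceOf d) * v (M.faceOf (M.rot (M.rot d)))),
      ← Equiv.sum_comp M.rot (fun e => u (M.faceOf e) * v (M.faceOf (M.rev e)))]
    simp only [hM.rot_rot_rot, faceOf_rev_rot]
  rw [h1, h2, CharTwo.add_self_eq_zero]

/-- Every face has an even number of corners. -/
theorem IsTwoColex.sum_face (hM : M.IsTwoColex) [Fintype D] (u : M.Face → ZMod 2)
    (hu : ∃ f, ∀ g, g ≠ f → u g = 0) : ∑ d, u (M.faceOf d) = 0 := by
  obtain ⟨f, hf⟩ := hu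
  obtain ⟨c, hc⟩ := hM.colorable
  -- Colour y differs from that of f. At each corner of f exactly one of the other two faces has
  -- colour y, so the cross sum against the indicator of y counts the corners of f.
  obtain ⟨y, hy⟩ : ∃ y, y ≠ c f := exists_ne _
  have h := hM.sum_cross u (fun g => if c g = y then 1 else 0)
  rw [← sum_add_distrib] at h
  rw [← h]
  refine sum_congr rfl fun d _ => ?_
  by_cases hd : M.faceOf d = f
  · have h1 := colour_rot_ne hc d
    have h2 := colour_rot_ne hc (M.rot d)
    have h3 := colour_rot_ne hc (M.rot (M.rot d))
    rw [hM.rot_rot_rot] at h3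
    rw [hd] at h1 h3 ⊢
    generalize c (M.faceOf (M.rot d)) = c1 at *
    generalize c (M.faceOf (M.rot (M.rot d))) = c2 at *
    generalize c f = c0 at *
    rw [← mul_add]
    have : ((if c1 = y then 1 else 0) + (if c2 = y then 1 else 0) : ZMod 2) = 1 := by
      clear hc hf h
      revert c0 c1 c2 y
      decide
    rw [this, mul_one]
  · simp [hf _ hd]

open Classical in
/-- Any two faces share an even number of vertices. -/
theorem IsTwoColex.sum_incident_mul (hM : M.IsTwoColex) (f g : M.Face) :
    ∑ a : M.Vertex, (if M.Incident a f then 1 else 0 : ZMod 2) *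
      (if M.Incident a g then 1 else 0) = 0 := by
  have := Fintype.ofFinite D
  rw [← hM.sum_vertexOf fun a => (if M.Incident a f then 1 else 0 : ZMod 2) *
      (if M.Incident a g then 1 else 0)]
  let x : M.Face → M.Face → ZMod 2 := fun f f' => if f' = f then 1 else 0
  have hx : ∀ (d : D) (f : M.Face), (if M.Incident (M.vertexOf d) f then 1 else 0 : ZMod 2) =
      x f (M.faceOf d) + (x f (M.faceOf (M.rot d)) + x f (M.faceOf (M.rot (M.rot d)))) := by
    intro d f
    rw [← hM.sum_incident d (x f)]
    simp [x]
  have hrot : ∀ h : D → ZMod 2, ∑ d, h (M.rot d) = ∑ d, h d := fun h => Equiv.sum_comp M.rot h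
  -- For f ≠ g this vanishes termwise; for f = g it is the parity of the number of corners of f.
  have hdiag : ∑ d, x f (M.faceOf d) * x g (M.faceOf d) = 0 := by
    refine hM.sum_face (fun e => x f e * x g e) ⟨f, fun e he => ?_⟩
    simp [x, he]
  have h1 := hrot fun d => x f (M.faceOf d) * x g (M.faceOf d)
  have h2 := hrot fun d => x f (M.faceOf (M.rot d)) * x g (M.faceOf (M.rot d))
  have h3 := hM.sum_cross (x f) (x g)
  have h4 := hrot fun d => x f (M.faceOf d) * x g (M.faceOf (M.rot d))
  have h5 := hrot fun d => x f (M.faceOf d) * x g (M.faceOf (M.rot (M.rot d)))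
  have h6 := hrot fun d => x f (M.faceOf (M.rot d)) * x g (M.faceOf (M.rot (M.rot d)))
  have h7 := hrot fun d => x f (M.faceOf (M.rot d)) * x g (M.faceOf (M.rot (M.rot (M.rot d))))
  simp only [hM.rot_rot_rot] at h1 h2 h3 h4 h5 h6 h7
  simp only [hx, mul_add, add_mul, sum_add_distrib]
  rw [h2, h1, hdiag, h6, h4, h7, h5]
  -- Of the nine products of corner indicators at a vertex, three are rotations of the diagonal term
  -- and six form three rotated copies of the cross sum.
  linear_combination 3 * h3

/-- The relation at a vertex makes t vanish on its third face too. The other end of an edge shares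
both sides of that edge, so the vanishing passes on to it, and connectedness carries it to every
face. -/
theorem IsTwoColex.faceOf_eq_zero (hM : M.IsTwoColex) {t : M.Face → ZMod 2}
    (ht : ∀ d, t (M.faceOf d) + (t (M.faceOf (M.rot d)) + t (M.faceOf (M.rot (M.rot d)))) = 0)
    {d : D} (h1 : t (M.faceOf d) = 0) (h2 : t (M.faceOf (M.rot d)) = 0) : t = 0 := by
  let P : D → Prop := fun d => t (M.faceOf d) = 0 ∧ t (M.faceOf (M.rot d)) = 0 ∧
    t (M.faceOf (M.rot (M.rot d))) = 0
  have hP : P d := ⟨h1, h2, by simpa [h1, h2] using ht d⟩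
  have hrot : ∀ d, P d ↔ P (M.rot d) := by
    intro d
    simp only [P, hM.rot_rot_rot]
    tauto
  have hrev' : ∀ d, P d → P (M.rev d) := by
    rintro d ⟨a1, a2, a3⟩
    have b1 : M.faceOf (M.rev d) = M.faceOf (M.rot (M.rot d)) := by
      conv_lhs => rw [← hM.rot_rot_rot d]
      rw [faceOf_rev_rot]
    have b2 : M.faceOf (M.rot (M.rot (M.rev d))) = M.faceOf d := by
      rw [← faceOf_rev_rot, hM.rot_rot_rot, M.rev_rev]
    have := ht (M.rev d)
    rw [b1, b2, a1, a3] at this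
    refine ⟨by rw [b1, a3], by simpa using this, by rw [b2, a1]⟩
  have hrev : ∀ d, P d ↔ P (M.rev d) :=
    fun d => ⟨hrev' d, fun h => by simpa [M.rev_rev] using hrev' _ h⟩
  have hall : ∀ g ∈ Subgroup.closure {M.rot, M.rev}, ∀ d, P d ↔ P (g d) := by
    intro g hg
    induction hg using Subgroup.closure_induction with
    | mem g hg =>
      rcases hg with rfl | rfl
      · exact hrot
      · exact hrev
    | one => exact fun d => Iff.rfl
    | mul g g' _ _ ih ih' => exact fun d => (ih' d).trans (ih (g' d))
    | inv g _ ih => exact fun d => by simpa using (ih (g⁻¹ d)).symm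
  funext f
  obtain ⟨d', rfl⟩ := Quotient.exists_rep f
  obtain ⟨g, hg⟩ := M.connected.exists_smul_eq d d'
  have := ((hall g g.2 d).mp hP).1
  have e : (g : Equiv.Perm D) d = d' := hg
  rw [e] at this
  exact this

end Faces

/-! ### The incidence matrix -/

section Matrix

variable {V F : ℕ} (eV : Fin V ≃ M.Vertex) (eF : Fin F ≃ M.Face)

open Classical in
/-- The vertex-face incidence matrix over the field with two elements. -/
noncomputable def incMatrix (M : SurfaceMap D) {V F : ℕ} (eV : Fin V ≃ M.Vertex)
    (eF : Fin F ≃ M.Face) (i j : ℕ) : ZMod 2 :=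
  if ∃ (v : Fin V) (f : Fin F), i = v ∧ j = f ∧ M.Incident (eV v) (eF f) then 1 else 0

open Classical in
theorem incMatrix_apply (v : Fin V) (f : Fin F) :
    M.incMatrix eV eF v f = if M.Incident (eV v) (eF f) then 1 else 0 := by
  have : (∃ (v' : Fin V) (f' : Fin F), (v : ℕ) = v' ∧ (f : ℕ) = f' ∧ M.Incident (eV v') (eF f')) ↔
      M.Incident (eV v) (eF f) := by
    simp [Fin.val_inj]
  simp only [incMatrix, this]

theorem holds_input (β : ℝ) (J : M.Vertex → ℝ) (ε p : ℝ) (ω : ℕ → Bool) :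
    RealRAM.Holds V F (M.incMatrix eV eF) (M.input eV eF β J ε p ω) := by
  intro i hi j hj
  have : ∀ (v : Fin V) (f : Fin F), i * F + j = v * F + f ↔ i = v ∧ j = f :=
    fun v f => RealRAM.index_inj hj f.2
  simp only [input, incMatrix]
  split_ifs with h1 h2 h2
  · simp [ZMod.val_one]
  · obtain ⟨-, v, f, h, hvf⟩ := h1
    exact absurd ⟨v, f, ((this v f).mp h).1, ((this v f).mp h).2, hvf⟩ h2
  · obtain ⟨v, f, hv, hf, hvf⟩ := h2
    exact absurd ⟨rfl, v, f, (this v f).mpr ⟨hv, hf⟩, hvf⟩ h1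
  · simp

open Classical in
theorem act_incMatrix [Finite D] (y : Fin F → ZMod 2) (v : Fin V) :
    act V F (M.incMatrix eV eF) y v = ∑ f with M.Incident (eV v) f, y (eF.symm f) := by
  rw [sum_filter, ← Equiv.sum_comp eF]
  simp [act, incMatrix_apply]

variable [Finite D]

theorem IsTwoColex.orth_incMatrix (hM : M.IsTwoColex) : Orth V F (M.incMatrix eV eF) := by
  classical
  intro j hj k hk
  rw [← hM.sum_incident_mul (eF ⟨j, hj⟩) (eF ⟨k, hk⟩), ← Equiv.sum_comp eV]
  refine sum_congr rfl fun v _ => ?_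
  rw [← incMatrix_apply, ← incMatrix_apply]

/-- A kernel vector is determined by its values on two adjacent faces, by `faceOf_eq_zero` applied
to differences. -/
theorem IsTwoColex.card_kernel_le (hM : M.IsTwoColex) :
    #{y : Fin F → ZMod 2 | act V F (M.incMatrix eV eF) y = 0} ≤ 2 ^ 2 := by
  classical
  obtain ⟨d⟩ := M.nonempty
  have hcard : #(univ : Finset (ZMod 2 × ZMod 2)) = 2 ^ 2 := rfl
  rw [← hcard]
  refine card_le_card_of_injOn (fun y => (y (eF.symm (M.faceOf d)),
    y (eF.symm (M.faceOf (M.rot d))))) (fun _ _ => by simp) ?_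
  intro y hy y' hy' h
  simp only [coe_filter, mem_univ, true_and, Set.mem_ofPred_eq] at hy hy'
  simp only [Prod.mk.injEq] at h
  have key : ∀ y, act V F (M.incMatrix eV eF) y = 0 → ∀ d, y (eF.symm (M.faceOf d)) +
      (y (eF.symm (M.faceOf (M.rot d))) + y (eF.symm (M.faceOf (M.rot (M.rot d))))) = 0 := by
    intro y hy d
    rw [← hM.sum_incident d (fun f => y (eF.symm f))]
    have := congrFun hy (eV.symm (M.vertexOf d))
    rw [act_incMatrix, Equiv.apply_symm_apply] at this
    exact this
  have h0 := hM.faceOf_eq_zero (t := fun f => y (eF.symm f) - y' (eF.symm f)) (d := d) (fun d => by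
    have h1 := key y hy d
    have h2 := key y' hy' d
    linear_combination h1 - h2) (by simp [h.1]) (by simp [h.2])
  funext j
  have := congrFun h0 (eF j)
  simpa [sub_eq_zero] using this

theorem IsTwoColex.size_bounds (hM : M.IsTwoColex) (eV : Fin V ≃ M.Vertex)
    (eF : Fin F ≃ M.Face) : 0 < V ∧ 0 < F ∧ F ≤ 3 * V := by
  classical
  have := Fintype.ofFinite D
  obtain ⟨d⟩ := M.nonempty
  have hV : Fintype.card M.Vertex = V := by simpa using (Fintype.card_congr eV).symm
  have hF : Fintype.card M.Face = F := by simpa using (Fintype.card_congr eF).symm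
  refine ⟨hV ▸ Fintype.card_pos_iff.mpr ⟨M.vertexOf d⟩,
    hF ▸ Fintype.card_pos_iff.mpr ⟨M.faceOf d⟩, ?_⟩
  have h1 : Fintype.card M.Face ≤ Fintype.card D :=
    Fintype.card_le_of_surjective M.faceOf Quotient.mk_surjective
  have h2 : Fintype.card D = 3 * Fintype.card M.Vertex := by
    rw [← card_univ, card_eq_sum_card_fiberwise (f := M.vertexOf) (t := univ) (by simp),
      sum_congr rfl (g := fun _ => 3)]
    · simp [mul_comm]
    · intro a _
      rw [← hM.degree a, ← Set.ncard_coe_finset]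
      simp
  omega

end Matrix

/-! ### The partition function -/

section Partition

/-- The sign `(-1) ^ x`. -/
def sign (x : ZMod 2) : ℤˣ := if x = 0 then 1 else -1

theorem sign_add (x y : ZMod 2) : sign (x + y) = sign x * sign y := by
  revert x y; decide

theorem sign_sum {ι : Type*} (s : Finset ι) (y : ι → ZMod 2) :
    sign (∑ i ∈ s, y i) = ∏ i ∈ s, sign (y i) := by
  classical
  induction s using Finset.induction_on with
  | empty => rfl
  | insert a s ha ih => rw [sum_insert ha, prod_insert ha, sign_add, ih]

theorem sign_bijective : Function.Bijective sign := by
  constructor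
  · intro x y
    revert x y
    decide
  · intro u
    rcases Int.units_eq_one_or u with rfl | rfl
    · exact ⟨0, rfl⟩
    · exact ⟨1, rfl⟩

variable {V F : ℕ} (eV : Fin V ≃ M.Vertex) (eF : Fin F ≃ M.Face) (β : ℝ) (J : M.Vertex → ℝ)

/-- The couplings as stored in memory. -/
noncomputable def couplings {M : SurfaceMap D} {V : ℕ} (eV : Fin V ≃ M.Vertex)
    (J : M.Vertex → ℝ) (k : ℕ) : ℝ :=
  if h : k < V then J (eV ⟨k, h⟩) else 0

theorem weight_eq (v : Fin V) (x : ZMod 2) :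
    RealRAM.weight β (couplings eV J) v x = Real.exp (β * (J (eV v) * ((sign x : ℤ) : ℝ))) := by
  rcases RealRAM.zmod_two_cases x with rfl | rfl
  · simp [RealRAM.weight, couplings, sign, mul_comm]
  · simp [RealRAM.weight, couplings, sign, mul_comm]

variable [Finite D]

theorem partitionFunction_eq : M.partitionFunction β J =
    ∑ y : Fin F → ZMod 2, ∏ v : Fin V,
      RealRAM.weight β (couplings eV J) v (act V F (M.incMatrix eV eF) y v) := by
  classical
  let e : (Fin F → ZMod 2) ≃ (M.Face → ℤˣ) := Equiv.arrowCongr eF (Equiv.ofBijective _ sign_bijective)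
  have he : ∀ y f, e y f = sign (y (eF.symm f)) := fun y f => rfl
  unfold partitionFunction
  rw [← Equiv.sum_comp e]
  refine sum_congr rfl fun y _ => ?_
  have : -β * M.energy J (e y) = ∑ v : Fin V, β * (J (eV v) *
      ((sign (act V F (M.incMatrix eV eF) y v) : ℤ) : ℝ)) := by
    unfold energy
    rw [neg_mul_neg, mul_sum, ← Equiv.sum_comp eV]
    refine sum_congr rfl fun v _ => ?_
    rw [act_incMatrix, sign_sum]
    push_cast
    simp only [he]
  rw [this, Real.exp_sum]
  exact prod_congr rfl fun v _ => (weight_eq eV β J v _).symm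

/-- The two powers of 2 under the roots differ by 2^4, whence the factor 4, and exp(2βJ_a) +
exp(-2βJ_a) is the squared norm of the weight pair at a. The exponent F - 2 is an integer, so it is
not truncated. -/
theorem error_eq (eF : Fin F ≃ M.Face) (ε : ℝ) : M.gammaFactor β J / √((2 : ℝ) ^ ((F : ℤ) - 2)) * ε =
    4 * ε * √(∏ a ∈ range V, normSq (RealRAM.weight β (couplings eV J) a)) := by
  have hF : Fintype.card M.Face = F := by simpa using (Fintype.card_congr eF).symm
  have h4 : √((2 : ℝ) ^ (F + 2)) / √((2 : ℝ) ^ ((F : ℤ) - 2)) = 4 := by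
    rw [← Real.sqrt_div (by positivity)]
    have : (2 : ℝ) ^ (F + 2) / (2 : ℝ) ^ ((F : ℤ) - 2) = 4 ^ 2 := by
      rw [zpow_sub₀ (by norm_num), zpow_natCast, pow_add]
      have : (2 : ℝ) ^ F ≠ 0 := by positivity
      field_simp
      norm_num
    rw [this]
    exact Real.sqrt_sq (by norm_num)
  have hprod : ∏ a, √(Real.exp (2 * β * J a) + Real.exp (-(2 * β * J a))) =
      √(∏ a ∈ range V, normSq (RealRAM.weight β (couplings eV J) a)) := by
    rw [prod_range, Real.sqrt_prod _ (fun v _ => normSq_nonneg _),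
      ← Equiv.prod_comp eV]
    refine prod_congr rfl fun v _ => ?_
    rw [RealRAM.normSq_eq, weight_eq, weight_eq, ← Real.exp_nat_mul, ← Real.exp_nat_mul]
    congr 3
    · simp [sign]; ring
    · simp [sign]; ring
  unfold gammaFactor
  rw [hF, hprod, mul_div_right_comm, h4]
  ring

end Partition

end SurfaceMap

/-! ## The algorithm -/

namespace RealRAM

open Finset ColumnReduction

/-- Programs without coin flips ignore the coins. -/
theorem Exec.with_coins {P : Prog} {s s' : State} {t : ℕ} (h : Exec P s t s')
    (hP : P.instrs.any Instr.flips = false) (ω : ℕ → Bool) :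
    Exec P { s with coins := ω } t { s' with coins := ω } := by
  have hHolds : ∀ (b : Test) (s : State), b.Holds { s with coins := ω } ↔ b.Holds s := by
    intro b s
    cases b <;> rfl
  induction h with
  | skip s => exact Exec.skip _
  | instr i s =>
    have : { i.apply s with coins := ω } = i.apply { s with coins := ω } := by
      cases i <;> first | rfl | simp [Prog.instrs, Instr.flips] at hP
    rw [this]
    exact Exec.instr i _
  | seq _ _ ih ih' =>
    simp only [Prog.instrs, List.any_append, Bool.or_eq_false_iff] at hP
    exact (ih hP.1).seq (ih' hP.2)
  | cond_true hb _ ih =>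
    simp only [Prog.instrs, List.any_append, Bool.or_eq_false_iff] at hP
    exact (ih hP.1).cond_true ((hHolds _ _).mpr hb)
  | cond_false hb _ ih =>
    simp only [Prog.instrs, List.any_append, Bool.or_eq_false_iff] at hP
    exact (ih hP.2).cond_false (mt (hHolds _ _).mp hb)
  | loop_true hb _ _ ih ih' => exact Exec.loop_true ((hHolds _ _).mpr hb) (ih hP) (ih' hP)
  | loop_false hb => exact Exec.loop_false (mt (hHolds _ _).mp hb)

/-- The deterministic part of the algorithm. -/
def prepareProg : Prog := setupProg ;; weightsProg ;; reduceProg ;; thresholdsProg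

/-- The whole algorithm. -/
def mainProg : Prog := prepareProg ;; averageProg

/-- The memory contents needed for sampling. -/
structure Prepared (V F m : ℕ) (w : ℕ → ZMod 2 → ℝ) (A A' : ℕ → ℕ → ZMod 2) (pv : ℕ → ℕ) (ε p : ℝ)
    (s : State) : Prop where
  nreg_zero : s.nreg 0 = V
  nreg_one : s.nreg 1 = F
  nreg_two : s.nreg 2 = 1
  nreg_three : s.nreg 3 = 2 ^ m
  rreg_one : s.rreg 1 = ε
  rreg_two : s.rreg 2 = p
  rreg_three : s.rreg 3 = 1
  rreg_five : s.rreg 5 = ∏ a ∈ range V, normSq (w a)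
  rreg_nine : s.rreg 9 = 0
  matrix : Holds V F A' s
  weights : ∀ a ≤ V, s.rarr 1 a = w a 0 ∧ s.rarr 2 a = w a 1
  thresholds : ∀ j < F, s.narr 2 j = threshold m (w (pv j)) ∧
    s.rarr 3 j = invProb m (threshold m (w (pv j))) 0 ∧
    s.rarr 4 j = invProb m (threshold m (w (pv j))) 1
  reduced : Reduced V F A A' pv F

theorem weight_pos (β : ℝ) (J : ℕ → ℝ) (a : ℕ) (x : ZMod 2) : 0 < weight β J a x := by
  unfold weight
  split_ifs <;> exact Real.exp_pos _

theorem runs_prepare {s : State} {V F : ℕ} {A : ℕ → ℕ → ZMod 2} {β ε p : ℝ} {J : ℕ → ℝ}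
    (hV : s.nreg 0 = V) (hF : s.nreg 1 = F) (h22 : s.nreg 22 = 0) (hβ : s.rreg 0 = β)
    (hε : s.rreg 1 = ε) (hp : s.rreg 2 = p) (h9 : s.rreg 9 = 0) (hJ : s.rarr 0 = J)
    (hJV : J V = 0) (hA : Holds V F A s) (hV0 : 0 < V) (hF0 : 0 < F) (hFV : F ≤ 3 * V) :
    Runs prepareProg s (1000 * V ^ 3) (fun s' => ∃ A' pv,
      Prepared V F (Nat.clog 2 (4 * F)) (weight β J) A A' pv ε p s') := by
  set m := Nat.clog 2 (4 * F) with hm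
  have hm1 : 4 * F ≤ 2 ^ m := Nat.le_pow_clog (by norm_num) _
  have hm2 : 2 ^ m ≤ 8 * F := by
    have h1 : 2 ^ (m - 1) < 4 * F := Nat.pow_pred_clog_lt_self (by norm_num) (by omega)
    have h2 : 0 < m := Nat.clog_pos (by norm_num) (by omega)
    have h3 : 2 ^ m = 2 * 2 ^ (m - 1) := by rw [← pow_succ', Nat.sub_add_cancel h2]
    omega
  have hm3 : m ≤ 8 * F := (Nat.lt_two_pow_self).le.trans hm2
  have hm4 : 4 ≤ 2 ^ m := le_trans (by omega) hm1
  refine Runs.mono (B := (6 + (m * 3 + 1)) + ((1 + ((V * (11 + 2) + 2) + 2)) +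
    ((F * (((3 + (V * (6 + 2) + 2)) +
      ((F * ((2 + ((1 + (V * (8 + 2) + 2)) + 1) + 1) + 2) + 2) + 1)) + 2) + 2) +
    (F * ((12 + ((2 ^ m * (2 + 1) + 1) + 6)) + 2) + 2)))) ?_ ?_ (fun _ h _ => h)
  swap
  -- After F ≤ 3V and 2^m ≤ 8F, the cubic term comes from adding columns (F·F·V); the thresholds
  -- cost F·2^m, which is quadratic.
  · have a1 : V ≤ V ^ 3 := Nat.le_self_pow (by norm_num) V
    have a2 : V ^ 2 ≤ V ^ 3 := Nat.pow_le_pow_right hV0 (by norm_num)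
    calc _ ≤ (6 + ((8 * (3 * V)) * 3 + 1)) + ((1 + ((V * (11 + 2) + 2) + 2)) +
          (((3 * V) * (((3 + (V * (6 + 2) + 2)) +
          (((3 * V) * ((2 + ((1 + (V * (8 + 2) + 2)) + 1) + 1) + 2) + 2) + 1)) + 2) + 2) +
          ((3 * V) * ((12 + (((8 * (3 * V)) * (2 + 1) + 1) + 6)) + 2) + 2))) := by
          gcongr <;> omega
      _ ≤ _ := by nlinarith
  refine Runs.seq (runs_setup hF) ?_
  rintro s1 ⟨b2, b3, b3', b4⟩ hs1
  refine Runs.seq (runs_weights (β := β) (J := J) ((hs1.nreg 0 (by decide)).trans hV) b2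
    ((hs1.rreg 0 (by decide)).trans hβ) b3 ((hs1.rreg 9 (by decide)).trans h9)
    ((hs1.rarr 0 (by decide)).trans hJ) hJV) ?_
  rintro s2 ⟨hw, h5⟩ hs2
  refine Runs.seq (runs_reduce (A := A)
    ((hs2.nreg 0 (by decide)).trans ((hs1.nreg 0 (by decide)).trans hV))
    ((hs2.nreg 1 (by decide)).trans ((hs1.nreg 1 (by decide)).trans hF))
    ((hs2.nreg 2 (by decide)).trans b2)
    ((hs2.nreg 22 (by decide)).trans ((hs1.nreg 22 (by decide)).trans h22)) hV0
    (hA.congr (fun _ _ _ _ => rfl) ((hs2.narr 0 (by decide)).trans (hs1.narr 0 (by decide))))) ?_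
  rintro s3 ⟨A', hA', hred⟩ hs3
  have hw3 : ∀ a ≤ V, s3.rarr 1 a = weight β J a 0 ∧ s3.rarr 2 a = weight β J a 1 := by
    rw [hs3.rarr 1 (by decide), hs3.rarr 2 (by decide)]
    exact hw
  have c1 : s3.nreg 1 = F :=
    (hs3.nreg 1 (by decide)).trans ((hs2.nreg 1 (by decide)).trans ((hs1.nreg 1 (by decide)).trans hF))
  have c2 : s3.nreg 2 = 1 := (hs3.nreg 2 (by decide)).trans ((hs2.nreg 2 (by decide)).trans b2)
  have c3 : s3.rreg 3 = 1 := (hs3.rreg 3 (by decide)).trans ((hs2.rreg 3 (by decide)).trans b3)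
  refine (runs_thresholds (V := V) (m := m) (w := weight β J) c1 c2 c3
    ((hs3.rreg 4 (by decide)).trans ((hs2.rreg 4 (by decide)).trans b4)) ?_ hw3
    (fun a _ => (threshold_lt hm4 (weight_pos β J a)).le)).mono le_rfl ?_
  · intro j hj
    rcases hred.pivot j hj with ⟨h, -⟩ | ⟨h, -⟩ <;> omega
  intro s4 hT hs4
  refine ⟨A', s3.narr 1, ?_⟩
  constructor
  · rw [hs4.nreg 0 (by decide), hs3.nreg 0 (by decide), hs2.nreg 0 (by decide),
      hs1.nreg 0 (by decide), hV]
  · rw [hs4.nreg 1 (by decide), c1]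
  · rw [hs4.nreg 2 (by decide), c2]
  · rw [hs4.nreg 3 (by decide), hs3.nreg 3 (by decide), hs2.nreg 3 (by decide), b3']
  · rw [hs4.rreg 1 (by decide), hs3.rreg 1 (by decide), hs2.rreg 1 (by decide),
      hs1.rreg 1 (by decide), hε]
  · rw [hs4.rreg 2 (by decide), hs3.rreg 2 (by decide), hs2.rreg 2 (by decide),
      hs1.rreg 2 (by decide), hp]
  · rw [hs4.rreg 3 (by decide), c3]
  · rw [hs4.rreg 5 (by decide), hs3.rreg 5 (by decide), h5]
  · rw [hs4.rreg 9 (by decide), hs3.rreg 9 (by decide), hs2.rreg 9 (by decide),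
      hs1.rreg 9 (by decide), h9]
  · exact hA'.congr (fun _ _ _ _ => rfl) (hs4.narr 0 (by decide))
  · rw [hs4.rarr 1 (by decide), hs4.rarr 2 (by decide)]
    exact hw3
  · exact hT
  · exact hred

/-! ### The number of samples -/

/-- The number of samples. -/
noncomputable def sampleCount (ε p : ℝ) : ℕ := ⌈16 * Real.log (2 / (1 - p)) / ε ^ 2⌉₊

section SampleCount

variable {ε p : ℝ}

theorem lt_sampleCount_iff (hε : 0 < ε) (hp : p < 1) (k : ℕ) :
    1 - p < 2 * Real.exp (-(ε * ε / 16)) ^ k ↔ k < sampleCount ε p := by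
  have hq : 0 < 1 - p := by linarith
  rw [sampleCount, Nat.lt_ceil, lt_div_iff₀ (by positivity), ← Real.exp_nat_mul,
    Real.log_div (by norm_num) hq.ne', ← Real.log_lt_log_iff hq (by positivity),
    Real.log_mul (by norm_num) (Real.exp_pos _).ne', Real.log_exp]
  constructor <;> intro h <;> linarith

theorem sampleCount_pos (hε : 0 < ε) (hp0 : 0 ≤ p) (hp : p < 1) : 0 < sampleCount ε p := by
  rw [← lt_sampleCount_iff hε hp]
  norm_num
  linarith

theorem sampleCount_le (hε : 0 < ε) (hp0 : 0 ≤ p) (hp : p < 1) :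
    (sampleCount ε p : ℝ) ≤ 33 * (max 1 (1 / ε ^ 2) * max 1 (Real.log (1 / (1 - p)))) := by
  have hq : 0 < 1 - p := by linarith
  set a := max 1 (1 / ε ^ 2)
  set b := max 1 (Real.log (1 / (1 - p)))
  have ha : 1 ≤ a := le_max_left _ _
  have hb : 1 ≤ b := le_max_left _ _
  have hlog : Real.log (2 / (1 - p)) ≤ 2 * b := by
    have h1 : Real.log (2 / (1 - p)) = Real.log 2 + Real.log (1 / (1 - p)) := by
      rw [← Real.log_mul (by norm_num) (by positivity)]
      congr 1
      ring
    have h2 : Real.log 2 ≤ 1 := by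
      have := Real.log_two_lt_d9
      linarith
    have h3 : Real.log (1 / (1 - p)) ≤ b := le_max_right _ _
    linarith
  have hlog0 : 0 ≤ Real.log (2 / (1 - p)) := by
    refine Real.log_nonneg ?_
    rw [le_div_iff₀ hq]
    linarith
  have hle : 16 * Real.log (2 / (1 - p)) / ε ^ 2 ≤ 32 * (a * b) := by
    have h1 : 1 / ε ^ 2 ≤ a := le_max_right _ _
    calc 16 * Real.log (2 / (1 - p)) / ε ^ 2 = 16 * (1 / ε ^ 2 * Real.log (2 / (1 - p))) := by ring
      _ ≤ 16 * (a * (2 * b)) := by gcongr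
      _ = _ := by ring
  -- The ceiling adds at most 1, which turns 32 into 33 because both maxima are at least 1.
  have hceil := Nat.ceil_lt_add_one (a := 16 * Real.log (2 / (1 - p)) / ε ^ 2) (by positivity)
  have hab : 1 ≤ a * b := one_le_mul_of_one_le_of_one_le ha hb
  unfold sampleCount
  linarith

end SampleCount

/-- Only sampling uses coins. The prepared state, and with it A', the pivots and the sample count,
is fixed before ω is chosen, so the output is an explicit function of ω to which the probability
estimate applies. -/
theorem exec_main {s : State} {V F m : ℕ} {w : ℕ → ZMod 2 → ℝ} {A A' : ℕ → ℕ → ZMod 2}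
    {pv : ℕ → ℕ} {ε p : ℝ} {t₀ : ℕ} {s₀ : State} (h₀ : Exec prepareProg s t₀ s₀)
    (hs₀ : Prepared V F m w A A' pv ε p s₀) (ht₀ : t₀ ≤ 1000 * V ^ 3) (hε : 0 < ε) (hp : p < 1)
    (hV0 : 0 < V) (hFV : F ≤ 3 * V) (hm : m ≤ 8 * F) (ω : ℕ → Bool) :
    ∃ (t : ℕ) (s' : State), Exec mainProg { s with coins := ω } t s' ∧
      t ≤ 1020 * V ^ 3 + sampleCount ε p * (1000 * V ^ 3) ∧
      s'.rreg 0 = (∑ k ∈ range (sampleCount ε p),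
        trunc (32 * √(∏ a ∈ range V, normSq (w a)) / ε)
          (estimator V F m w A' (fun j => threshold m (w (pv j)))
            (sampleBit m (fun j => threshold m (w (pv j))) fun n => ω (n + k * (F * m))))) /
        sampleCount ε p := by
  obtain ⟨t, s', he, ht, hout⟩ := runs_average (s := { s₀ with coins := ω }) (ω := ω) hs₀.nreg_zero
    hs₀.nreg_one hs₀.nreg_two hs₀.nreg_three rfl hs₀.rreg_one hs₀.rreg_two hs₀.rreg_three
    hs₀.rreg_five hs₀.rreg_nine (hs₀.matrix.congr (fun _ _ _ _ => rfl) rfl) hs₀.weights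
    hs₀.thresholds (lt_sampleCount_iff hε hp)
  refine ⟨t₀ + t, s', (h₀.with_coins (by decide) ω).seq he, ?_, hout⟩
  set N := sampleCount ε p
  have a1 : V ≤ V ^ 3 := Nat.le_self_pow (by norm_num) V
  have a2 : V ^ 2 ≤ V ^ 3 := Nat.pow_le_pow_right hV0 (by norm_num)
  have hbody : (((1 + (F * (((2 + (m * (4 + 1) + 1)) + 8) + 2) + 2)) +
      ((1 + (V * ((1 + ((F * (6 + 2) + 2) + 4)) + 2) + 2)) + 4)) + 1) ≤ 1000 * V ^ 3 := by
    calc _ ≤ (((1 + ((3 * V) * (((2 + ((8 * (3 * V)) * (4 + 1) + 1)) + 8) + 2) + 2)) +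
          ((1 + (V * ((1 + (((3 * V) * (6 + 2) + 2) + 4)) + 2) + 2)) + 4)) + 1) := by
          gcongr
          omega
      _ ≤ _ := by nlinarith
  have := Nat.mul_le_mul_left N hbody
  omega

end RealRAM

/-- One fixed program which, on every 2-colex, every inverse temperature, all real couplings, every
`ε > 0` and every `0 ≤ p < 1`, halts for all coin flips within
`C * V ^ 3 * max 1 (1 / ε ^ 2) * max 1 (log (1 / (1 - p)))` steps and leaves in real register `0`
an estimate of the partition function that has the stated accuracy with probability at least `p`. -/
theorem mainTheorem1 :
    ∃ (P : RealRAM.Prog) (C : ℝ),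
      ∀ (D : Type) [Finite D] (M : SurfaceMap D) (V F : ℕ)
        (eV : Fin V ≃ M.Vertex) (eF : Fin F ≃ M.Face)
        (β : ℝ) (J : M.Vertex → ℝ) (ε p : ℝ), M.IsTwoColex → 0 < ε → 0 ≤ p → p < 1 →
        (∀ ω : ℕ → Bool, ∃ (t : ℕ) (s : RealRAM.State),
          RealRAM.Exec P (M.input eV eF β J ε p ω) t s ∧
          (t : ℝ) ≤ C * (V : ℝ) ^ 3 * max 1 (1 / ε ^ 2) * max 1 (Real.log (1 / (1 - p)))) ∧
        ENNReal.ofReal p ≤ RealRAM.coinMeasure {ω : ℕ → Bool |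
          ∃ (t : ℕ) (s : RealRAM.State),
            RealRAM.Exec P (M.input eV eF β J ε p ω) t s ∧
            |s.rreg 0 - M.partitionFunction β J| ≤
              M.gammaFactor β J / Real.sqrt ((2 : ℝ) ^ ((F : ℤ) - 2)) * ε} := by
  -- 34020 = 1020 + 33·1000: preparation with constant overhead, plus 33 times the cost of one
  -- sample.
  refine ⟨RealRAM.mainProg, 34020, ?_⟩
  intro D _ M V F eV eF β J ε p hM hε hp0 hp
  obtain ⟨hV0, hF0, hFV⟩ := hM.size_bounds eV eF
  obtain ⟨t₀, s₀, h₀, ht₀, A', pv, hs₀⟩ := RealRAM.runs_prepare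
    (s := M.input eV eF β J ε p fun _ => false) (V := V) (F := F) (A := M.incMatrix eV eF) (β := β)
    (ε := ε) (p := p) (J := SurfaceMap.couplings eV J) rfl rfl rfl rfl rfl rfl rfl
    (by funext k; simp [SurfaceMap.input, SurfaceMap.couplings])
    (by simp [SurfaceMap.couplings])
    (M.holds_input eV eF β J ε p _) hV0 hF0 hFV
  have hm1 : 4 * F ≤ 2 ^ Nat.clog 2 (4 * F) := Nat.le_pow_clog (by norm_num) _
  have hm2 : Nat.clog 2 (4 * F) ≤ 8 * F :=
    (Nat.clog_le_of_le_pow (Nat.lt_two_pow_self).le).trans (by omega)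
  have hexec := RealRAM.exec_main h₀ hs₀ ht₀ hε hp hV0 hFV hm2
  refine ⟨fun ω => ?_, ?_⟩
  · obtain ⟨t, s, he, ht, -⟩ := hexec ω
    refine ⟨t, s, he, ?_⟩
    have hN := RealRAM.sampleCount_le hε hp0 hp
    set a := max 1 (1 / ε ^ 2)
    set b := max 1 (Real.log (1 / (1 - p)))
    have hab : 1 ≤ a * b := one_le_mul_of_one_le_of_one_le (le_max_left _ _) (le_max_left _ _)
    have ht' : (t : ℝ) ≤ 1020 * (V : ℝ) ^ 3 + RealRAM.sampleCount ε p * (1000 * (V : ℝ) ^ 3) := by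
      exact_mod_cast ht
    calc (t : ℝ) ≤ 1020 * (V : ℝ) ^ 3 + RealRAM.sampleCount ε p * (1000 * (V : ℝ) ^ 3) := ht'
      _ ≤ 1020 * (V : ℝ) ^ 3 * (a * b) + 33 * (a * b) * (1000 * (V : ℝ) ^ 3) := by
          refine add_le_add (le_mul_of_one_le_right (by positivity) hab) ?_
          gcongr
      _ = _ := by ring
  · have hprob := RealRAM.le_coinMeasure_average hs₀.reduced (hM.orth_incMatrix eV eF)
      (hM.card_kernel_le eV eF) (RealRAM.weight_pos β (SurfaceMap.couplings eV J)) (fun x => by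
        simp [RealRAM.weight, SurfaceMap.couplings]) hF0 hm1 hε (RealRAM.sampleCount_pos hε hp0 hp)
      -- The loop test fails at k = N, which is exactly the required bound on the failure
      -- probability.
      (p := p) (not_lt.mp (mt (RealRAM.lt_sampleCount_iff hε hp _).mp (lt_irrefl _)))
    refine hprob.trans (MeasureTheory.measure_mono fun ω hω => ?_)
    obtain ⟨t, s, he, -, hout⟩ := hexec ω
    refine ⟨t, s, he, ?_⟩
    rw [hout, SurfaceMap.partitionFunction_eq eV eF, SurfaceMap.error_eq eV β J eF]
    exact hω
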